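/- Let $n\ge 2$ and let $\{K_t\}_{t\ge 0}$ be a family of knots in $S^3$ twisted on $n$ coherently oriented strands: $K_0$ is given by an oriented long knot diagram $D_0$, $U$ is a disk in the plane that meets $D_0$ in $n$ parallel strands without crossings, all oriented in the same direction (say upward, numbered $1,\dots,n$ from left to right), and $K_t$ is the knot whose diagram is obtained from $D_0$ by replacing $U$ with $t$ positive full twists, i.e. with the braid $(\sigma_1\sigma_2\cdots\sigma_{n-1})^{nt}$. Let $\Delta_{K_t}(T)\in\mathbb Z[T,T^{-1}]$ be the symmetrized Alexander polynomial of $K_t$ (the generator of the first elementary ideal of the Alexander matrix with $\Delta_{K_t}(T^{-1})=\Delta_{K_t}(T)$ and $\Delta_{K_t}(1)=1$). Then the sequence $p_t=T^{tn(n-1)/2}\Delta_{K_t}(T)$ stabilizes positively: for every $r_0\in\mathbb Z$ there is $t_0$ such that for all $t\ge t_0$ and all $r\le r_0$ the coefficients of $T^r$ in $p_t$ and in $p_{t_0}$ agree. The limiting Laurent series is the expansion at $T=0$ of a rational function $F(T)\in\mathbb Q(T)$, given explicitly by $$F(T)=T^{(-\varphi(D_0)-w(D_0))/2}\,\det(I-A_\infty).$$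 Here $\varphi(D_0)$ is the total turning number of $D_0$ (counterclockwise minus clockwise full turns), $w(D_0)$ is its writhe, and $\varphi(D_0)+w(D_0)$ is even. $A_\infty$ is the transition matrix, indexed by the strands of $D_0\setminus U$, of the following chain: a particle arriving at a crossing of sign $\sigma$ on the over-strand continues on the outgoing over-strand with weight $T^\sigma$ and jumps to the outgoing under-strand with weight $1-T^\sigma$; a particle arriving on the under-strand continues on the outgoing under-strand with weight $1$; a particle on the $i$-th strand entering $U$ passes to the $j$-th strand leaving $U$ with weight $T^{j-1}/(1+T+\cdots+T^{n-1})$ (an infinite twist vertex); all other weights are $0$. The rational function $F$ is not a polynomial (nor a Laurent polynomial), it is regular at $T=1$, and $F(1)=\pm\frac1n$. -/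

import Mathlib

open scoped LaurentPolynomial

noncomputable section

namespace TwistedKnots

/-! ### Stabilization of Laurent polynomials -/

/-- For every `r₀`, the coefficients of `p t` in degrees `≤ r₀` are eventually constant in `t`,
simultaneously for all these degrees. -/
def StabilizesPositively (p : ℕ → ℤ[T;T⁻¹]) : Prop :=
  ∀ r₀ : ℤ, ∃ t₀ : ℕ, ∀ t, t₀ ≤ t → ∀ r : ℤ, r ≤ r₀ → (p t).coeff r = (p t₀).coeff r

/-- The Laurent series `L` is the limit of the sequence `p`: for every `r₀`, the coefficients of
`p t` in degrees `≤ r₀` are those of `L` for all large `t`. -/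
def HasStableLimit (p : ℕ → ℤ[T;T⁻¹]) (L : LaurentSeries ℚ) : Prop :=
  ∀ r₀ : ℤ, ∃ t₀ : ℕ, ∀ t, t₀ ≤ t → ∀ r : ℤ, r ≤ r₀ → (((p t).coeff r : ℤ) : ℚ) = L.coeff r

/-! ### Fox calculus -/

/-- The Fox derivative with respect to the generator `k` of a word in the free group on `S`
(`(s, true)` is the letter `s` and `(s, false)` the letter `s⁻¹`), abelianized by sending every
generator to `T`. It satisfies `∂(u v) = ∂u + u ∂v`. -/
def foxDeriv {S : Type*} [DecidableEq S] (k : S) : List (S × Bool) → ℤ[T;T⁻¹]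
  | [] => 0
  | (s, true) :: w => (if s = k then 1 else 0) + LaurentPolynomial.T 1 * foxDeriv k w
  | (s, false) :: w =>
      LaurentPolynomial.T (-1) * (foxDeriv k w - (if s = k then 1 else 0))

/-- The ideal generated by the `d × d` minors of a matrix. -/
def minorIdeal {ρ γ R : Type*} [CommRing R] (M : Matrix ρ γ R) (d : ℕ) : Ideal R :=
  Ideal.span {x | ∃ (f : Fin d → ρ) (g : Fin d → γ), x = (M.submatrix f g).det}

/-! ### Long knot diagrams -/

/-- A passage of the knot through a crossing `c`: `(c, true)` is the passage along the
over-strand, `(c, false)` the one along the under-strand. -/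
abbrev Passage (C : Type*) := C × Bool

/-- The strands (the pieces of the diagram between consecutive crossing points).
`some v` is the strand that leads into the passage `v`, `none` is the last, outgoing strand. -/
abbrev Strand (C : Type*) := Option (Passage C)

/-- The combinatorial data (signed Gauss code) of an oriented long knot diagram with set of
crossings `C`: the signs of the crossings, the first (incoming) strand, and for every passage the
strand on which the knot leaves it. -/
structure LongDiagram (C : Type*) where
  sign : C → ℤˣ
  first : Strand C
  next : Passage C → Strand C

namespace LongDiagram

variable {C : Type*}

/-- The strand following a given one (the last strand is left fixed). -/
def succ (D : LongDiagram C) : Strand C → Strand C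
  | some v => D.next v
  | none => none

/-- Following the orientation from the first strand one meets every strand exactly once, so that
the diagram is a single arc. -/
def IsLongKnot [Fintype C] (D : LongDiagram C) : Prop :=
  Function.Bijective fun k : Fin (Fintype.card (Strand C)) => D.succ^[k] D.first

/-- The passage `v` is met strictly before the passage `w`. -/
def Before (D : LongDiagram C) (v w : Passage C) : Prop :=
  ∃ k : ℕ, D.succ^[k + 1] (some v) = some w

/-! The four strands at a crossing, drawn with both strands oriented upward. At a positive crossing
the over-strand runs from bottom left to top right and the under-strand from bottom right to top
left; at a negative crossing over and under are exchanged. -/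

def bottomLeft (D : LongDiagram C) (c : C) : Strand C :=
  if D.sign c = 1 then some (c, true) else some (c, false)

def bottomRight (D : LongDiagram C) (c : C) : Strand C :=
  if D.sign c = 1 then some (c, false) else some (c, true)

def topLeft (D : LongDiagram C) (c : C) : Strand C :=
  if D.sign c = 1 then D.next (c, false) else D.next (c, true)

def topRight (D : LongDiagram C) (c : C) : Strand C :=
  if D.sign c = 1 then D.next (c, true) else D.next (c, false)

/-- Each strand `s` has a left side `(s, true)` and a right side `(s, false)`. Two sides are
adjacent if they meet in one of the four corners at a crossing, or at infinity, where the last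
strand is joined to the first one. -/
inductive Adjacent (D : LongDiagram C) : Strand C × Bool → Strand C × Bool → Prop
  | bottom (c : C) : Adjacent D (D.bottomLeft c, false) (D.bottomRight c, true)
  | right (c : C) : Adjacent D (D.bottomRight c, false) (D.topRight c, false)
  | top (c : C) : Adjacent D (D.topLeft c, false) (D.topRight c, true)
  | left (c : C) : Adjacent D (D.bottomLeft c, true) (D.topLeft c, true)
  | infinity (b : Bool) : Adjacent D (D.first, b) (none, b)

/-- The faces (complementary regions) of the diagram on the closed oriented surface obtained by
capping off: the classes of sides under the equivalence relation generated by adjacency. -/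
def Face (D : LongDiagram C) : Type _ := Quot D.Adjacent

/-- The face on the left of a strand. -/
def leftFace (D : LongDiagram C) (s : Strand C) : D.Face := Quot.mk _ (s, true)

/-- The face on the right of a strand. -/
def rightFace (D : LongDiagram C) (s : Strand C) : D.Face := Quot.mk _ (s, false)

/-- The surface carrying the diagram is a sphere, that is, its Euler characteristic
`c - 2c + (number of faces)` is `2`, where `c` is the number of crossings. -/
def IsPlanar [Fintype C] (D : LongDiagram C) : Prop :=
  Nat.card D.Face = Fintype.card C + 2

/-- The writhe. -/
def writhe [Fintype C] (D : LongDiagram C) : ℤ := ∑ c, (D.sign c : ℤ)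

open Classical in
/-- The total turning number (counterclockwise full turns minus clockwise full turns) of the arc,
by Whitney's formula: a crossing counts `+1` if its second passage crosses the first one from left
to right, and `-1` if it does so from right to left. -/
def turningNumber [Fintype C] (D : LongDiagram C) : ℤ :=
  ∑ c, if D.Before (c, false) (c, true) then (D.sign c : ℤ) else -(D.sign c : ℤ)

/-! ### The Alexander polynomial -/

/-- The relators of the Wirtinger presentation of the knot group, with one generator for every
strand and base point below the plane of projection: a meridian does not change where its strand
passes under, and where it passes over it is conjugated by the meridian of the under-strand. -/
def wirtinger (D : LongDiagram C) : Passage C → List (Strand C × Bool)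
  | (c, false) => [(some (c, false), true), (D.next (c, false), false)]
  | (c, true) =>
      if D.sign c = 1 then
        [(some (c, true), false), (D.next (c, false), true), (D.next (c, true), true),
          (D.next (c, false), false)]
      else
        [(some (c, true), false), (D.next (c, false), false), (D.next (c, true), true),
          (D.next (c, false), true)]

/-- The Alexander matrix: abelianized Fox derivatives of the Wirtinger relators. -/
def alexanderMatrix [DecidableEq C] (D : LongDiagram C) :
    Matrix (Passage C) (Strand C) ℤ[T;T⁻¹] :=
  Matrix.of fun v s => foxDeriv s (D.wirtinger v)

/-- `f` is the symmetrized Alexander polynomial of the knot with diagram `D`: it generates the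
first elementary ideal of the Alexander matrix, `f(T⁻¹) = f(T)` and `f(1) = 1`. -/
def IsAlexanderPolynomial [Fintype C] [DecidableEq C] (D : LongDiagram C) (f : ℤ[T;T⁻¹]) : Prop :=
  minorIdeal D.alexanderMatrix (Fintype.card (Strand C) - 1) = Ideal.span {f} ∧
    LaurentPolynomial.invert f = f ∧
    LaurentPolynomial.eval₂ (RingHom.id ℤ) (1 : ℤˣ) f = 1

/-! ### Twisting -/

/-- `e 0, …, e (n - 1)` are distinct strands that run in parallel, in this order from left to right
and all in the same direction, through a disk `U`: the face on the right of each is the face on the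
left of the following one. Equivalently, an arc crosses exactly these strands, in this order and
each from left to right. -/
def IsCoherentBand (D : LongDiagram C) {n : ℕ} (e : Fin n → Strand C) : Prop :=
  Function.Injective e ∧
    ∀ p q : Fin n, (q : ℕ) = p + 1 → D.rightFace (e p) = D.leftFace (e q)

/-! A full twist is the braid `(σ₁ ⋯ σₙ₋₁)ⁿ`. In a braid with `m` rows, each of them equal to
`σ₁ ⋯ σₙ₋₁`, the crossing `(r, k)` is the letter in row `r` which exchanges the (0-based) positions
`k` and `k + 1`; it is positive, its over-strand goes from position `k` to `k + 1` and its
under-strand from `k + 1` to `k`. In each row, the strand at position `0` passes over all the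
others. When such a braid is inserted at the strands `e p`, the upper part of `e p`, above the
braid, keeps its name. -/

/-- A strand of the original diagram as a strand of the diagram with the inserted braid. -/
def keep (m n : ℕ) : Strand C → Strand (C ⊕ Fin m × Fin (n - 1)) :=
  Option.map fun v => (Sum.inl v.1, v.2)

/-- The strand found at position `p` immediately below row `r` of the inserted braid with `m` rows;
above the last row it is the upper part of `e p`. -/
def braidStrand {n : ℕ} (e : Fin n → Strand C) (m r : ℕ) (p : Fin n) :
    Strand (C ⊕ Fin m × Fin (n - 1)) :=
  if hr : r < m then
    if hp : 0 < (p : ℕ) then some (Sum.inr (⟨r, hr⟩, ⟨p - 1, by omega⟩), false)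
    else if hn : 0 < n - 1 then some (Sum.inr (⟨r, hr⟩, ⟨0, hn⟩), true)
    else keep m n (e p)
  else keep m n (e p)

/-- Insert at the strands `e p` a braid with `m` rows `σ₁ ⋯ σₙ₋₁`. A piece of the knot which
arrives on the strand `e p` now enters the braid at position `p`. -/
def insertRows (D : LongDiagram C) {n : ℕ} (e : Fin n → Strand C) (m : ℕ) :
    LongDiagram (C ⊕ Fin m × Fin (n - 1)) where
  sign := Sum.elim D.sign fun _ => 1
  first := Function.extend e (braidStrand e m 0) (keep m n) D.first
  next
    | (Sum.inl c, b) => Function.extend e (braidStrand e m 0) (keep m n) (D.next (c, b))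
    | (Sum.inr (r, k), true) =>
        if h : (k : ℕ) + 1 < n - 1 then some (Sum.inr (r, ⟨k + 1, h⟩), true)
        else braidStrand e m (r + 1) ⟨k + 1, by omega⟩
    | (Sum.inr (r, k), false) => braidStrand e m (r + 1) ⟨k, by omega⟩

/-- Insert `t` positive full twists `(σ₁ ⋯ σₙ₋₁)ⁿ` at the strands `e p`. -/
def twist (D : LongDiagram C) {n : ℕ} (e : Fin n → Strand C) (t : ℕ) :
    LongDiagram (C ⊕ Fin (t * n) × Fin (n - 1)) :=
  D.insertRows e (t * n)

/-! ### The chain with an infinite twist vertex -/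

/-- The strand of `D - U` on which a walk leaves the passage `v`. The strands of `D - U` are
`Sum.inr p`, the strand that enters `U` at position `p` (the lower part of `e p`), and `Sum.inl s`,
the strand `s` of `D`, or its upper part, leaving `U`, if `s` is one of the `e p`. -/
def outerNext (D : LongDiagram C) {n : ℕ} (e : Fin n → Strand C) (v : Passage C) :
    Strand C ⊕ Fin n :=
  Function.extend e Sum.inr Sum.inl (D.next v)

/-- The transition matrix of the Markov chain obtained by replacing `U` with an infinite twist
vertex. A particle arriving at a crossing of sign `σ` on the over-strand stays on it with weight
`T ^ σ` and jumps down with weight `1 - T ^ σ`, on the under-strand it goes on with weight `1`, and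
a particle that enters the vertex leaves it at the `q`-th position with weight
`T ^ (q - 1) / (1 + T + ⋯ + T ^ (n - 1))`. -/
def infiniteTwistMatrix [DecidableEq C] (D : LongDiagram C) {n : ℕ} (e : Fin n → Strand C) :
    Matrix (Strand C ⊕ Fin n) (Strand C ⊕ Fin n) (RatFunc ℚ) :=
  Matrix.of fun
    | Sum.inl (some (c, true)), y =>
        (if y = D.outerNext e (c, true) then RatFunc.X ^ (D.sign c : ℤ) else 0) +
          (if y = D.outerNext e (c, false) then 1 - RatFunc.X ^ (D.sign c : ℤ) else 0)
    | Sum.inl (some (c, false)), y => if y = D.outerNext e (c, false) then 1 else 0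
    | Sum.inl none, _ => 0
    | Sum.inr _, y =>
        ∑ q : Fin n, if y = Sum.inl (e q) then
          RatFunc.X ^ (q : ℕ) / ∑ i ∈ Finset.range n, RatFunc.X ^ i else 0

end LongDiagram

end TwistedKnots

end

/-! Up to unit factors in the rows, the Alexander matrix consists of rows of `1 - A`, where `A` is
the transition matrix of the random walk on the strands. Hence the Alexander polynomial is `det (1 -
A)` up to a factor ±T^k (`minorIdeal_alexanderMatrix`). Inside the inserted braid the walk only
moves forward, so the strands of the braid can be eliminated, and the twists enter only through a
power of the Burau matrix B of σ₁⋯σₙ₋₁ (`det_one_sub_transition_insertRows`).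

Let P be the matrix all of whose rows are T^q / (1 + ⋯ + T^(n-1)). Then B^(tn) = P + T^(tn) (1 - P)
(`rowMatrix_pow_eq_add_smul`). The determinant is therefore a polynomial in s = T^(tn) with
coefficients independent of t. Its constant term is the determinant of the chain with an infinite
twist vertex; the other terms move off to arbitrarily high degree at T = 0.

The unit ±T^k is found at T = 1: a symmetric f with f(1) = 1 has f'(1) = 0, so k is minus the
derivative of the determinant there. At T = 1 the walk simply follows the knot, and `(1 - A)⁻¹` is
the order of the strands along it. A trace computation gives the derivative `underFirst` + t
n(n-1)/2 (`bandDet_epsUnit`), with `underFirst` equal to (φ + w)/2. The prefactor of p_t thus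
cancels exactly the part that depends on t.

The same description of the walk at T = 1 reduces F(1) to an n × n determinant with value 1/n
(`bandDet_one_geomMatrix`). The coefficients of F are coefficients of integral Laurent polynomials,
so if F were a Laurent polynomial, F(1) would be an integer, which 1/n is not. -/

namespace TwistedKnots

/-! ### Determinants -/

section Determinants

variable {R : Type*} [CommRing R]

/-- `1 - A` is unimodular if `A` is strictly triangular with respect to a height function. -/
theorem det_one_sub_of_height {Y : Type*} [Fintype Y] [DecidableEq Y] (A : Matrix Y Y R)
    (h : Y → ℕ) (hA : ∀ a b, A a b ≠ 0 → h a < h b) : (1 - A).det = 1 := by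
  have htri : (1 - A).BlockTriangular h := by
    intro a b hab
    have h1 : A a b = 0 := by
      by_contra hne
      exact absurd (hA a b hne) (by omega)
    have h2 : a ≠ b := by rintro rfl; omega
    simp [h1, Matrix.one_apply_ne h2]
  rw [htri.det]
  refine Finset.prod_eq_one fun k _ => ?_
  have : (1 - A).toSquareBlock h k = 1 := by
    ext ⟨a, ha⟩ ⟨b, hb⟩
    have h1 : A a b = 0 := by
      by_contra hne
      exact absurd (hA a b hne) (by omega)
    simp [Matrix.toSquareBlock_def, h1, Matrix.one_apply]
  rw [this, Matrix.det_one]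

/-- Elimination of the states `Y` from a chain with transition matrix `A` on `Z ⊕ Y ≃ S`, where the
rows of `V` describe how the states of `Y` are absorbed in `Z`. -/
theorem det_one_sub_eliminate {S Z Y : Type*} [Fintype S] [DecidableEq S] [Fintype Z]
    [DecidableEq Z] [Fintype Y] [DecidableEq Y] (ι : Z ⊕ Y ≃ S) (A : Matrix S S R)
    (V : Matrix S Z R) (hZ : ∀ z, V (ι (Sum.inl z)) = (1 : Matrix Z Z R) z)
    (hY : ∀ y, V (ι (Sum.inr y)) = (A * V) (ι (Sum.inr y)))
    (h : Y → ℕ) (hh : ∀ y y', A (ι (Sum.inr y)) (ι (Sum.inr y')) ≠ 0 → h y < h y') :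
    (1 - A).det = (1 - (A * V).submatrix (ι ∘ Sum.inl) id).det := by
  rw [← Matrix.det_submatrix_equiv_self ι (1 - A)]
  set A' : Matrix (Z ⊕ Y) (Z ⊕ Y) R := A.submatrix ι ι with hA'
  set W : Matrix Y Z R := Matrix.of fun y z => V (ι (Sum.inr y)) z with hW
  have hV : ∀ s z, (A * V) (ι s) z
      = A' s (Sum.inl z) + ∑ y, A' s (Sum.inr y) * W y z := by
    intro s z
    rw [Matrix.mul_apply, ← ι.sum_comp, Fintype.sum_sum_type]
    simp [hZ, hA', hW, Matrix.one_apply]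
  have h1 : (1 - A).submatrix ι ι = 1 - A' := by
    ext i j
    simp [hA', Matrix.one_apply]
  -- A unimodular column operation: adding the `Y`-columns weighted by `W` to the `Z`-columns kills
  -- the lower left block, by `hY`, and puts the reduced chain in the upper left one.
  have h2 : (1 - A') * Matrix.fromBlocks 1 0 W 1
      = Matrix.fromBlocks (1 - (A * V).submatrix (ι ∘ Sum.inl) id) (-A'.toBlocks₁₂) 0
          (1 - A'.toBlocks₂₂) := by
    have h3 : 1 - A' = Matrix.fromBlocks (1 - A'.toBlocks₁₁) (-A'.toBlocks₁₂) (-A'.toBlocks₂₁)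
        (1 - A'.toBlocks₂₂) := by
      conv_lhs => rw [← Matrix.fromBlocks_toBlocks A', ← Matrix.fromBlocks_one]
      ext (i | i) (j | j) <;> simp [Matrix.one_apply]
    rw [h3, Matrix.fromBlocks_multiply]
    congr 1
    · ext z z'
      have := hV (Sum.inl z) z'
      simp only [Matrix.mul_one, Matrix.neg_mul, Matrix.add_apply, Matrix.sub_apply,
        Matrix.neg_apply, Matrix.submatrix_apply, Function.comp_apply, id_eq, this,
        Matrix.toBlocks₁₁, Matrix.toBlocks₁₂, Matrix.mul_apply, Matrix.of_apply]
      ring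
    · simp
    · ext y z
      have := hV (Sum.inr y) z
      rw [← hY] at this
      simp only [Matrix.mul_one, Matrix.sub_mul, Matrix.one_mul, Matrix.add_apply,
        Matrix.sub_apply, Matrix.neg_apply, Matrix.zero_apply, Matrix.toBlocks₂₁,
        Matrix.toBlocks₂₂, Matrix.mul_apply, Matrix.of_apply]
      have hWy : W y z = V (ι (Sum.inr y)) z := rfl
      rw [hWy, this]
      ring
    · simp
  have h4 : (Matrix.fromBlocks (1 : Matrix Z Z R) 0 W 1).det = 1 := by
    simp
  have h5 : (1 - A'.toBlocks₂₂).det = 1 :=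
    det_one_sub_of_height _ h fun y y' hy => hh y y' hy
  rw [h1, ← mul_one (1 - A').det, ← h4, ← Matrix.det_mul, h2, Matrix.det_fromBlocks_zero₂₁, h5,
    mul_one]

/-- `det (M + s K)` is a polynomial in `s`. -/
theorem exists_det_add_smul_eq {X : Type*} [Fintype X] [DecidableEq X] (M K : Matrix X X R) :
    ∃ p : Polynomial R, ∀ s : R, (M + s • K).det = M.det + s * p.eval s := by
  set P : Matrix X X (Polynomial R) := M.map Polynomial.C + (Polynomial.X : Polynomial R) •
    K.map Polynomial.C with hP
  have hev : ∀ s : R, (M + s • K).det = P.det.eval s := by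
    intro s
    rw [← Polynomial.coe_evalRingHom, RingHom.map_det]
    congr 1
    ext i j
    simp only [hP, Polynomial.coe_evalRingHom, RingHom.mapMatrix_apply, Matrix.map_apply,
      Matrix.add_apply, Matrix.smul_apply, smul_eq_mul, Polynomial.eval_add, Polynomial.eval_mul,
      Polynomial.eval_C, Polynomial.eval_X]
  -- The constant coefficient of the polynomial `P.det` is `M.det`; `divX` divides what remains by
  -- the variable.
  refine ⟨P.det.divX, fun s => ?_⟩
  have h0 := hev 0
  rw [zero_smul, add_zero] at h0
  rw [hev, h0, ← Polynomial.coeff_zero_eq_eval_zero]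
  conv_lhs => rw [← Polynomial.divX_mul_X_add P.det]
  simp
  ring

theorem det_one_sub_eps_smul {X : Type*} [Fintype X] [DecidableEq X] (r : R) (hr : r * r = 0)
    (M : Matrix X X R) : (1 - r • M).det = 1 - r * M.trace := by
  have := Matrix.det_one_add_smul r (-M)
  rw [smul_neg, ← sub_eq_add_neg] at this
  rw [this, sq, hr, Matrix.trace_neg]
  ring

end Determinants

/-! ### Maximal minors of a matrix with vanishing row sums -/

/-- The column `none` is minus the sum of the others, so `M` is its square part times a fixed matrix
`E`. Every maximal minor is then a multiple of the determinant of the square part. -/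
theorem minorIdeal_eq_span_of_row_sum_eq_zero {R ρ : Type*} [CommRing R] [Fintype ρ]
    [DecidableEq ρ] (M : Matrix ρ (Option ρ) R) (hM : ∀ r, ∑ s, M r s = 0) :
    minorIdeal M (Fintype.card ρ) = Ideal.span {(M.submatrix id some).det} := by
  set σ : Fin (Fintype.card ρ) ≃ ρ := (Fintype.equivFin ρ).symm
  apply le_antisymm
  · refine Ideal.span_le.2 ?_
    rintro _ ⟨f, g, rfl⟩
    set E : Matrix ρ (Option ρ) R :=
      Matrix.of fun r s => s.elim (-1) fun r' => if r = r' then 1 else 0 with hE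
    have hME : M = M.submatrix id some * E := by
      ext r s
      have := hM r
      rw [Fintype.sum_option] at this
      rcases s with _ | s
      · simp [hE, Matrix.mul_apply]
        linear_combination this
      · simp [hE, Matrix.mul_apply]
    have h1 : M.submatrix f g = (1 : Matrix ρ ρ R).submatrix f σ
        * ((M.submatrix id some).submatrix σ σ * E.submatrix σ g) := by
      conv_lhs => rw [hME]
      rw [Matrix.submatrix_mul_equiv, Matrix.submatrix_mul_equiv, Matrix.one_mul]
    rw [h1, Matrix.det_mul, Matrix.det_mul, Matrix.det_submatrix_equiv_self]
    exact Ideal.mul_mem_left _ _ (Ideal.mul_mem_right _ _ (Ideal.mem_span_singleton_self _))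
  · rw [Ideal.span_singleton_le_iff_mem]
    refine Ideal.subset_span ⟨σ, fun i => some (σ i), ?_⟩
    rw [← Matrix.det_submatrix_equiv_self σ]
    rfl

theorem det_option_of_none_row {R ρ : Type*} [CommRing R] [Fintype ρ] [DecidableEq ρ]
    (M : Matrix (Option ρ) (Option ρ) R) (h : M none = (1 : Matrix (Option ρ) (Option ρ) R) none) :
    M.det = (M.submatrix some some).det := by
  rw [← Matrix.det_submatrix_equiv_self (Equiv.optionEquivSumPUnit.{0} ρ).symm,
    ← Matrix.fromBlocks_toBlocks (M.submatrix _ _)]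
  have h21 : (M.submatrix (Equiv.optionEquivSumPUnit.{0} ρ).symm
      (Equiv.optionEquivSumPUnit.{0} ρ).symm).toBlocks₂₁ = 0 := by
    ext i j
    simp [Matrix.toBlocks₂₁, h]
  rw [h21, Matrix.det_fromBlocks_zero₂₁, Matrix.det_unique (Matrix.toBlocks₂₂ _)]
  simp [Matrix.toBlocks₂₂, h]
  rfl

end TwistedKnots

namespace TwistedKnots

/-! ### The Burau matrix of a full twist -/

section FullTwist

variable {R : Type*} [CommRing R] {n : ℕ}

/-- The distribution of the final positions of a particle that travels on the over-strand of the
braid `σ₁ ⋯ σₙ₋₁` and has reached the position `k`. -/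
def overRow (T : R) (k : ℕ) (j : Fin n) : R :=
  if k ≤ j then (1 - T) * T ^ ((j : ℕ) - k) + (if (j : ℕ) + 1 = n then T ^ (n - k) else 0) else 0

/-- The Burau matrix of the braid `σ₁ ⋯ σₙ₋₁`. -/
def rowMatrix (T : R) : Matrix (Fin n) (Fin n) R :=
  Matrix.of fun p q =>
    if (p : ℕ) = 0 then overRow T 0 q else if (q : ℕ) + 1 = p then 1 else 0

/-- The matrix all of whose rows are `1, T, …, T ^ (n - 1)`. -/
def geomMatrix (T : R) : Matrix (Fin n) (Fin n) R := Matrix.of fun _ q => T ^ (q : ℕ)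

/-- The effect of one positive crossing: with weight 1 - T the particle drops to the under-strand
and ends at position k, with weight T it travels on. -/
theorem overRow_step (T : R) (k : ℕ) (hk : k + 1 < n) (j : Fin n) :
    overRow T k j = (1 - T) * (if (j : ℕ) = k then 1 else 0) + T * overRow T (k + 1) j := by
  unfold overRow
  rcases lt_trichotomy (j : ℕ) k with h | h | h
  · rw [if_neg (show ¬ k ≤ (j : ℕ) by omega), if_neg (show ¬ (j : ℕ) = k by omega),
      if_neg (show ¬ k + 1 ≤ (j : ℕ) by omega)]
    ring
  · rw [if_pos (show k ≤ (j : ℕ) by omega), if_neg (show ¬ (j : ℕ) + 1 = n by omega), if_pos h,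
      if_neg (show ¬ k + 1 ≤ (j : ℕ) by omega), h]
    simp
  · rw [if_pos (show k ≤ (j : ℕ) by omega), if_neg (show ¬ (j : ℕ) = k by omega),
      if_pos (show k + 1 ≤ (j : ℕ) by omega)]
    have h1 : (j : ℕ) - k = (j - (k + 1)) + 1 := by omega
    have h2 : n - k = n - (k + 1) + 1 := by omega
    rw [h1, h2]
    split_ifs <;> ring

theorem overRow_last (T : R) (k : ℕ) (hk : k + 1 = n) (j : Fin n) :
    overRow T k j = if (j : ℕ) = k then 1 else 0 := by
  unfold overRow
  by_cases h : (j : ℕ) = k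
  · rw [if_pos (by omega), if_pos (by omega), if_pos h, h]
    have : n - k = 1 := by omega
    simp [this]
  · rw [if_neg (by omega), if_neg h]

/-- The vector (1, T, …, T^(n-1)) is an invariant measure of the walk through one row. It is what
survives in the infinite twist. -/
theorem geom_vecMul_rowMatrix (T : R) (q : Fin n) :
    ∑ k : Fin n, T ^ (k : ℕ) * rowMatrix T k q = T ^ (q : ℕ) := by
  have hn : 0 < n := q.pos
  obtain ⟨n, rfl⟩ : ∃ l, n = l + 1 := ⟨n - 1, by omega⟩
  rw [Fin.sum_univ_succ]
  have h1 : ∀ k : Fin n, T ^ ((k.succ : Fin (n + 1)) : ℕ) * rowMatrix T k.succ q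
      = if (k : ℕ) = q then T ^ ((q : ℕ) + 1) else 0 := by
    intro k
    simp only [rowMatrix, Matrix.of_apply, Fin.val_succ, Nat.succ_ne_zero, if_false,
      Nat.add_right_cancel_iff]
    by_cases h : (q : ℕ) = k <;> simp [h, eq_comm]
  simp_rw [h1]
  simp only [rowMatrix, Matrix.of_apply, Fin.val_zero, if_true, overRow, Nat.zero_le, pow_zero,
    one_mul, Nat.sub_zero]
  by_cases hq : (q : ℕ) = n
  · rw [Finset.sum_eq_zero fun k _ => if_neg (by omega), if_pos (by omega), hq]
    ring
  · rw [Finset.sum_eq_single (⟨q, by omega⟩ : Fin n), if_pos rfl, if_neg (by omega)]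
    · ring
    · intro b _ hb
      exact if_neg fun h => hb (Fin.ext h)
    · simp

/-- A particle starting at p slides left by one position per row until it reaches 0. The next row
carries it along the over-strand: this leaves the invariant part (1 - T) T^q and a remainder T^n at
position n - 1, which slides left again. For j ≤ n the remainder has no second turn as over-strand.
-/
theorem rowMatrix_pow_apply (T : R) (j : ℕ) (hj : j ≤ n) (p q : Fin n) :
    (rowMatrix T ^ j) p q = if j ≤ p then (if (q : ℕ) + j = p then 1 else 0)
      else (1 - T) * T ^ (q : ℕ) + (if (q : ℕ) + j = n + p then T ^ n else 0) := by
  induction j generalizing q with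
  | zero =>
    simp [Matrix.one_apply, Fin.ext_iff, eq_comm]
  | succ j ih =>
    rw [pow_succ, Matrix.mul_apply]
    simp_rw [ih (by omega)]
    by_cases hp : j ≤ p
    · simp only [if_pos hp]
      rw [Finset.sum_eq_single (⟨p - j, by omega⟩ : Fin n)]
      · simp only [rowMatrix, Matrix.of_apply]
        rw [if_pos (by omega), one_mul]
        by_cases hpj : j + 1 ≤ p
        · rw [if_neg (by omega), if_pos hpj]
          congr 1
          exact propext ⟨fun h => by omega, fun h => by omega⟩
        · rw [if_pos (by omega), if_neg hpj]
          simp only [overRow, Nat.zero_le, if_true, Nat.sub_zero]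
          congr 2
          exact propext ⟨fun h => by omega, fun h => by omega⟩
      · intro b _ hb
        rw [if_neg, zero_mul]
        exact fun h => hb (Fin.ext (by simp; omega))
      · simp
    · simp only [if_neg hp, if_neg (show ¬ j + 1 ≤ (p : ℕ) by omega), add_mul, mul_assoc]
      rw [Finset.sum_add_distrib, ← Finset.mul_sum, geom_vecMul_rowMatrix]
      congr 1
      rw [Finset.sum_eq_single (⟨n + p - j, by omega⟩ : Fin n)]
      · simp only [rowMatrix, Matrix.of_apply]
        rw [if_pos (by omega), if_neg (by omega)]
        by_cases h : (q : ℕ) + (j + 1) = n + p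
        · rw [if_pos h, if_pos (by omega), mul_one]
        · rw [if_neg h, if_neg (by omega), mul_zero]
      · intro b _ hb
        rw [if_neg, zero_mul]
        exact fun h => hb (Fin.ext (by simp; omega))
      · simp

/-- After n rows every remainder is back at its starting position, hence the scalar part T^n. -/
theorem rowMatrix_pow_self (T : R) :
    (rowMatrix T : Matrix (Fin n) (Fin n) R) ^ n
      = T ^ n • (1 : Matrix (Fin n) (Fin n) R) + (1 - T) • geomMatrix T := by
  ext p q
  rw [rowMatrix_pow_apply T n le_rfl, if_neg (by omega)]
  simp only [geomMatrix, Matrix.add_apply, Matrix.smul_apply, Matrix.of_apply, smul_eq_mul,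
    Matrix.one_apply, Fin.ext_iff]
  by_cases h : (p : ℕ) = q
  · rw [if_pos (by omega), if_pos h]; ring
  · rw [if_neg (by omega), if_neg h]; ring

theorem geomMatrix_mul_self (T : R) :
    (geomMatrix T : Matrix (Fin n) (Fin n) R) * geomMatrix T
      = (∑ i ∈ Finset.range n, T ^ i) • geomMatrix T := by
  ext p q
  simp [geomMatrix, Matrix.mul_apply, ← Finset.sum_mul, Finset.sum_range]

/-- The Burau matrix of `t` full twists. -/
theorem rowMatrix_pow_mul (T : R) (t : ℕ) :
    (rowMatrix T : Matrix (Fin n) (Fin n) R) ^ (t * n)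
      = T ^ (t * n) • (1 : Matrix (Fin n) (Fin n) R)
        + ((1 - T) * ∑ i ∈ Finset.range t, T ^ (i * n)) • geomMatrix T := by
  induction t with
  | zero => simp
  | succ t ih =>
    rw [Nat.succ_mul, pow_add, ih, rowMatrix_pow_self, Finset.sum_range_succ, pow_add]
    simp only [add_mul, mul_add, Matrix.smul_mul, Matrix.mul_smul, Matrix.one_mul, Matrix.mul_one,
      geomMatrix_mul_self, smul_smul]
    rw [add_assoc, ← add_smul, ← add_smul]
    congr 2
    · ring
    -- The coefficient of `geomMatrix` closes up because (1 - T)(1 + ⋯ + T^(n-1)) + T^n = 1.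
    · have := mul_neg_geom_sum T n
      linear_combination (1 - T) * (∑ i ∈ Finset.range t, T ^ (i * n)) * this

end FullTwist

/-! ### The random walk on the strands, with a general vertex in place of the disk -/

namespace LongDiagram

variable {C : Type*} [DecidableEq C] {R : Type*} [CommRing R]

/-- The transition matrix of the random walk on the strands of a diagram. -/
def transition (D : LongDiagram C) (T : Rˣ) : Matrix (Strand C) (Strand C) R :=
  Matrix.of fun
    | some (c, true), s =>
        ((T ^ (D.sign c : ℤ) : Rˣ) : R) * (1 : Matrix (Strand C) (Strand C) R) (D.next (c, true)) s
          + (1 - ((T ^ (D.sign c : ℤ) : Rˣ) : R)) *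
            (1 : Matrix (Strand C) (Strand C) R) (D.next (c, false)) s
    | some (c, false), s => (1 : Matrix (Strand C) (Strand C) R) (D.next (c, false)) s
    | none, _ => 0

/-- The transition matrix from the lower to the upper part of the strands `e p` that is given by
`Q`, extended by the identity on the other strands. -/
noncomputable def bandMatrix {n : ℕ} (e : Fin n → Strand C) (Q : Matrix (Fin n) (Fin n) R) :
    Matrix (Strand C) (Strand C) R :=
  Matrix.of <| Function.extend e (fun p z => ∑ q, Q p q * (1 : Matrix (Strand C) (Strand C) R) (e q) z)
    (1 : Matrix (Strand C) (Strand C) R)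

section

variable {n : ℕ} {e : Fin n → Strand C}

theorem bandMatrix_apply_band (he : Function.Injective e) (Q : Matrix (Fin n) (Fin n) R)
    (p : Fin n) (z : Strand C) :
    bandMatrix e Q (e p) z = ∑ q, Q p q * (1 : Matrix (Strand C) (Strand C) R) (e q) z := by
  rw [bandMatrix, Matrix.of_apply]
  exact congrFun (he.extend_apply _ _ p) z

theorem bandMatrix_apply_of_notMem (Q : Matrix (Fin n) (Fin n) R) {s : Strand C}
    (hs : ¬ ∃ p, e p = s) (z : Strand C) :
    bandMatrix e Q s z = (1 : Matrix (Strand C) (Strand C) R) s z := by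
  rw [bandMatrix, Matrix.of_apply]
  exact congrFun (Function.extend_apply' _ _ _ hs) z

variable [Fintype C] (D : LongDiagram C) (T : Rˣ) {X : Type*} (V : Matrix (Strand C) X R)

theorem transition_mul_over (c : C) (x : X) :
    (D.transition T * V) (some (c, true)) x
      = ((T ^ (D.sign c : ℤ) : Rˣ) : R) * V (D.next (c, true)) x
        + (1 - ((T ^ (D.sign c : ℤ) : Rˣ) : R)) * V (D.next (c, false)) x := by
  simp [Matrix.mul_apply, transition, Matrix.one_apply, add_mul, Finset.sum_add_distrib]

theorem transition_mul_under (c : C) (x : X) :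
    (D.transition T * V) (some (c, false)) x = V (D.next (c, false)) x := by
  simp [Matrix.mul_apply, transition, Matrix.one_apply]

theorem transition_mul_none (x : X) : (D.transition T * V) none x = 0 := by
  simp [Matrix.mul_apply, transition]

end

theorem transition_map {R' : Type*} [CommRing R'] (φ : R →+* R') (D : LongDiagram C) (T : Rˣ) :
    (D.transition T).map φ = D.transition (Units.map (φ : R →* R') T) := by
  ext s z
  rcases s with _ | ⟨c, _ | _⟩ <;>
    simp [transition, Matrix.one_apply, apply_ite φ, ← map_zpow]

theorem bandMatrix_map {R' : Type*} [CommRing R'] (φ : R →+* R') {n : ℕ} {e : Fin n → Strand C}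
    (he : Function.Injective e) (Q : Matrix (Fin n) (Fin n) R) :
    (bandMatrix e Q).map φ = bandMatrix e (Q.map φ) := by
  ext s z
  by_cases hs : ∃ p, e p = s
  · obtain ⟨p, rfl⟩ := hs
    simp [bandMatrix_apply_band he, Matrix.one_apply, apply_ite φ]
  · simp [bandMatrix_apply_of_notMem _ hs, Matrix.one_apply, apply_ite φ]

/-- The determinant of the chain in which the disk with the strands `e p` is replaced by a vertex
with transition matrix `Q`. -/
noncomputable def bandDet [Fintype C] (D : LongDiagram C) (T : Rˣ) {n : ℕ} (e : Fin n → Strand C)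
    (Q : Matrix (Fin n) (Fin n) R) : R :=
  (1 - D.transition T * bandMatrix e Q).det

/-- Naturality in the ring carries the determinant from Laurent polynomials to dual numbers and to
rational functions, and from functions regular at 1 to rational functions and to their values. -/
theorem map_bandDet [Fintype C] {R' : Type*} [CommRing R'] (φ : R →+* R') (D : LongDiagram C)
    (T : Rˣ) {n : ℕ} {e : Fin n → Strand C} (he : Function.Injective e)
    (Q : Matrix (Fin n) (Fin n) R) :
    φ (D.bandDet T e Q) = D.bandDet (Units.map (φ : R →* R') T) e (Q.map φ) := by
  rw [bandDet, bandDet, RingHom.map_det, map_sub, map_one, map_mul, RingHom.mapMatrix_apply,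
    RingHom.mapMatrix_apply, transition_map, bandMatrix_map φ he]

end LongDiagram

end TwistedKnots

namespace TwistedKnots

namespace LongDiagram

/-- Used to see that the walk moves upward through the rows of the braid. -/
theorem braidStrand_eq_some_inr {C : Type*} {n : ℕ} {e : Fin n → Strand C} {m r : ℕ} {p : Fin n} {r' : Fin m} {k : Fin (n - 1)} {b : Bool}
    (h : braidStrand e m r p = some (Sum.inr (r', k), b)) : (r' : ℕ) = r := by
  have hk : ∀ s : Strand C, keep m n s ≠ some (Sum.inr (r', k), b) := by
    rintro (_ | ⟨c, b⟩) <;> simp [keep]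
  unfold braidStrand at h
  split_ifs at h with hr hp hn'
  · simp only [Option.some.injEq, Prod.mk.injEq, Sum.inr.injEq] at h
    rw [← h.1.1]
  · simp only [Option.some.injEq, Prod.mk.injEq, Sum.inr.injEq] at h
    rw [← h.1.1]
  · exact absurd h (hk _)
  · exact absurd h (hk _)

variable {C : Type*} [DecidableEq C]

/-! ### The Alexander matrix and the random walk -/

/-- The variable `T` as a unit. -/
noncomputable def unitT : (ℤ[T;T⁻¹])ˣ where
  val := LaurentPolynomial.T 1
  inv := LaurentPolynomial.T (-1)
  val_inv := by rw [← LaurentPolynomial.T_add]; simp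
  inv_val := by rw [← LaurentPolynomial.T_add]; simp

theorem transition_row_sum [Fintype C] {R : Type*} [CommRing R] (D : LongDiagram C) (T : Rˣ)
    (v : Passage C) : ∑ s, D.transition T (some v) s = 1 := by
  obtain ⟨c, _ | _⟩ := v <;>
    simp [transition, Matrix.one_apply, Finset.sum_add_distrib]

/-- The unit by which the rows of the Alexander matrix differ from those of `1 - A`. -/
noncomputable def rowUnit : Passage C → (ℤ[T;T⁻¹])ˣ
  | (_, true) => -unitT⁻¹
  | (_, false) => 1

/-- The relator of an under-passage gives a row of `1 - A` itself. The relator of an over-passage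
begins with an inverse letter, which accounts for the factor -T⁻¹; its conjugating letters produce
the weight 1 - T^σ. -/
theorem alexanderMatrix_apply (D : LongDiagram C) (v : Passage C) (s : Strand C) :
    D.alexanderMatrix v s = (rowUnit v : ℤ[T;T⁻¹]) * (1 - D.transition unitT) (some v) s := by
  have h1 : (LaurentPolynomial.T (-1) : ℤ[T;T⁻¹]) * LaurentPolynomial.T 1 = 1 := unitT.inv_val
  obtain ⟨c, _ | _⟩ := v
  · simp only [alexanderMatrix, wirtinger, foxDeriv, Matrix.of_apply, rowUnit, Units.val_one,
      one_mul, Matrix.sub_apply, Matrix.one_apply, transition]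
    linear_combination (-if D.next (c, false) = s then (1 : ℤ[T;T⁻¹]) else 0) * h1
  · rcases Int.units_eq_one_or (D.sign c) with h | h
    · simp only [alexanderMatrix, wirtinger, foxDeriv, Matrix.of_apply, rowUnit,
        Matrix.sub_apply, Matrix.one_apply, transition, h, if_true, Units.val_one, zpow_one,
        Units.val_neg]
      have e1 : ((unitT⁻¹ : (ℤ[T;T⁻¹])ˣ) : ℤ[T;T⁻¹]) = LaurentPolynomial.T (-1) := rfl
      have e2 : (unitT : ℤ[T;T⁻¹]) = LaurentPolynomial.T 1 := rfl
      rw [e1, e2]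
      linear_combination (-LaurentPolynomial.T 1 * LaurentPolynomial.T (-1) *
        if D.next (c, false) = s then (1 : ℤ[T;T⁻¹]) else 0) * h1
    · simp only [alexanderMatrix, wirtinger, foxDeriv, Matrix.of_apply, rowUnit,
        Matrix.sub_apply, Matrix.one_apply, transition, h, Units.val_one, Units.val_neg,
        zpow_neg, zpow_one, if_neg (show ¬ (-1 : ℤˣ) = 1 by decide)]
      have e1 : ((unitT⁻¹ : (ℤ[T;T⁻¹])ˣ) : ℤ[T;T⁻¹]) = LaurentPolynomial.T (-1) := rfl
      rw [e1]
      linear_combination (LaurentPolynomial.T (-1) *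
        if D.next (c, false) = s then (1 : ℤ[T;T⁻¹]) else 0) * h1

/-- The weights leaving a passage sum to 1, so the rows sum to zero and the minor omitting the
column of the last strand generates. The last strand has no exit, so its row in `1 - A` is that of
the identity, and this minor is the full determinant up to a unit. -/
theorem minorIdeal_alexanderMatrix [Fintype C] (D : LongDiagram C) :
    minorIdeal D.alexanderMatrix (Fintype.card (Strand C) - 1)
      = Ideal.span {(1 - D.transition unitT).det} := by
  have hc : Fintype.card (Strand C) - 1 = Fintype.card (Passage C) := by
    rw [Fintype.card_option]; rfl
  rw [hc, minorIdeal_eq_span_of_row_sum_eq_zero]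
  · have h1 : D.alexanderMatrix.submatrix id some = Matrix.of fun v w : Passage C =>
        (rowUnit v : ℤ[T;T⁻¹]) * ((1 - D.transition unitT).submatrix some some) v w := by
      ext1 v w
      simp only [Matrix.submatrix_apply, id, alexanderMatrix_apply, Matrix.of_apply]
    rw [h1, Matrix.det_mul_column, det_option_of_none_row (1 - D.transition unitT)]
    · exact Ideal.span_singleton_mul_left_unit
        (IsUnit.prod_iff.2 fun v _ => (rowUnit v).isUnit) _
    · ext s
      simp [transition]
  · intro v
    simp_rw [alexanderMatrix_apply]
    rw [← Finset.mul_sum]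
    simp only [Matrix.sub_apply, Finset.sum_sub_distrib, transition_row_sum]
    simp [Matrix.one_apply]

/-! ### Elimination of the strands of an inserted braid -/

section Elimination

variable {R : Type*} [CommRing R] {n : ℕ} {e : Fin n → Strand C}

/-- Absorption of a walk on the strands of a diagram with an inserted braid in the strands of the
original diagram. -/
noncomputable def absorption (T : R) (e : Fin n → Strand C) (m : ℕ) :
    Matrix (Strand (C ⊕ Fin m × Fin (n - 1))) (Strand C) R :=
  Matrix.of fun
    | none, z => (1 : Matrix (Strand C) (Strand C) R) none z
    | some (Sum.inl c, b), z => (1 : Matrix (Strand C) (Strand C) R) (some (c, b)) z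
    | some (Sum.inr (r, k), true), z =>
        ∑ j, overRow T k j * bandMatrix e (rowMatrix T ^ (m - (r + 1))) (e j) z
    | some (Sum.inr (r, k), false), z =>
        bandMatrix e (rowMatrix T ^ (m - (r + 1))) (e ⟨k, by omega⟩) z

theorem absorption_keep (T : R) (m : ℕ) (s z : Strand C) :
    absorption T e m (keep m n s) z = (1 : Matrix (Strand C) (Strand C) R) s z := by
  rcases s with _ | ⟨c, b⟩ <;> rfl

theorem bandMatrix_mul_apply (he : Function.Injective e) (P Q : Matrix (Fin n) (Fin n) R)
    (p : Fin n) (z : Strand C) :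
    bandMatrix e (P * Q) (e p) z = ∑ j, P p j * bandMatrix e Q (e j) z := by
  simp_rw [bandMatrix_apply_band he, Matrix.mul_apply, Finset.sum_mul, Finset.mul_sum, mul_assoc]
  exact Finset.sum_comm

theorem bandMatrix_one (he : Function.Injective e) :
    bandMatrix e (1 : Matrix (Fin n) (Fin n) R) = 1 := by
  ext s z
  by_cases hs : ∃ p, e p = s
  · obtain ⟨p, rfl⟩ := hs
    rw [bandMatrix_apply_band he]
    simp [Matrix.one_apply (n := Fin n)]
  · rw [bandMatrix_apply_of_notMem _ hs]

/-- Below row r there are m - r rows still to cross. Peeling one factor off the power, a position p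
> 0 moves under to p - 1, and position 0 starts along the over-strand. -/
theorem absorption_braidStrand (he : Function.Injective e) (hn : 2 ≤ n) (T : R) (m r : ℕ)
    (p : Fin n) (z : Strand C) :
    absorption T e m (braidStrand e m r p) z = bandMatrix e (rowMatrix T ^ (m - r)) (e p) z := by
  unfold braidStrand
  split_ifs with hr hp hn'
  · have h1 : m - r = (m - (r + 1)) + 1 := by omega
    rw [h1, pow_succ', bandMatrix_mul_apply he, Finset.sum_eq_single (⟨p - 1, by omega⟩ : Fin n)]
    · simp only [rowMatrix, Matrix.of_apply]
      rw [if_neg (by omega), if_pos (by omega), one_mul]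
      rfl
    · intro b _ hb
      simp only [rowMatrix, Matrix.of_apply]
      rw [if_neg (by omega), if_neg fun h => hb (Fin.ext (by simp; omega)), zero_mul]
    · simp
  · have h1 : m - r = (m - (r + 1)) + 1 := by omega
    rw [h1, pow_succ', bandMatrix_mul_apply he]
    change ∑ j, overRow T 0 j * bandMatrix e (rowMatrix T ^ (m - (r + 1))) (e j) z = _
    refine Finset.sum_congr rfl fun j _ => ?_
    simp only [rowMatrix, Matrix.of_apply]
    rw [if_pos (by omega)]
  · omega
  · rw [absorption_keep, Nat.sub_eq_zero_of_le (by omega), pow_zero, bandMatrix_one he]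

theorem absorption_extend (he : Function.Injective e) (hn : 2 ≤ n) (T : R) (m : ℕ)
    (s z : Strand C) :
    absorption T e m (Function.extend e (braidStrand e m 0) (keep m n) s) z
      = bandMatrix e (rowMatrix T ^ m) s z := by
  by_cases hs : ∃ p, e p = s
  · obtain ⟨p, rfl⟩ := hs
    rw [he.extend_apply, absorption_braidStrand he hn, Nat.sub_zero]
  · rw [Function.extend_apply' _ _ _ hs, absorption_keep, bandMatrix_apply_of_notMem _ hs]

/-- The strands of the diagram with an inserted braid are the old strands and those that lead into
a crossing of the braid. -/
def strandEquiv (C : Type*) (m n : ℕ) :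
    Strand C ⊕ (Fin m × Fin (n - 1)) × Bool ≃ Strand (C ⊕ Fin m × Fin (n - 1)) where
  toFun := Sum.elim (keep m n) fun y => some (Sum.inr y.1, y.2)
  invFun
    | none => Sum.inl none
    | some (Sum.inl c, b) => Sum.inl (some (c, b))
    | some (Sum.inr y, b) => Sum.inr (y, b)
  left_inv := by rintro ((_ | ⟨c, b⟩) | ⟨y, b⟩) <;> rfl
  right_inv := by rintro (_ | ⟨c | y, b⟩) <;> rfl

theorem det_one_sub_transition_insertRows [Fintype C] (D : LongDiagram C) (T : Rˣ)
    (he : Function.Injective e) (hn : 2 ≤ n) (m : ℕ) :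
    (1 - (D.insertRows e m).transition T).det = D.bandDet T e (rowMatrix (T : R) ^ m) := by
  -- The height r n + k increases at each step inside the braid: the over-strand raises k within its
  -- row, every other move leads to row r + 1, and k < n - 1.
  rw [det_one_sub_eliminate (strandEquiv C m n) _ (absorption (T : R) e m) ?_ ?_
    (fun y => (y.1.1 : ℕ) * n + y.1.2) ?_, bandDet]
  · congr 2
    ext s z
    rcases s with _ | ⟨c, _ | _⟩
    · rw [transition_mul_none]
      exact transition_mul_none _ _ _ _
    · rw [transition_mul_under, ← absorption_extend he hn]
      exact transition_mul_under _ _ _ _ _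
    · rw [transition_mul_over, ← absorption_extend he hn, ← absorption_extend he hn]
      exact transition_mul_over _ _ _ _ _
  · rintro (_ | ⟨c, b⟩) <;> rfl
  · rintro ⟨⟨r, k⟩, _ | _⟩ <;> ext z
    · refine Eq.trans ?_ (transition_mul_under _ _ _ _ _).symm
      exact (absorption_braidStrand he hn (T : R) m (r + 1) ⟨k, by omega⟩ z).symm
    · refine Eq.trans ?_ (transition_mul_over _ _ _ _ _).symm
      have h1 : (insertRows D e m).next (Sum.inr (r, k), false)
        = braidStrand e m (r + 1) ⟨k, by omega⟩ := rfl
      have h2 : (insertRows D e m).sign (Sum.inr (r, k)) = 1 := rfl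
      have h3 : absorption (T : R) e m (strandEquiv C m n (Sum.inr ((r, k), true))) z
        = ∑ j, overRow (T : R) k j * bandMatrix e (rowMatrix (T : R) ^ (m - (r + 1))) (e j) z := rfl
      have h4 : absorption (T : R) e m ((insertRows D e m).next (Sum.inr (r, k), true)) z
        = ∑ j, overRow (T : R) (k + 1) j *
          bandMatrix e (rowMatrix (T : R) ^ (m - (r + 1))) (e j) z := by
        simp only [insertRows]
        split_ifs with hk
        · rfl
        · rw [absorption_braidStrand he hn]
          simp_rw [overRow_last (n := n) (T : R) (k + 1) (by omega)]
          rw [Finset.sum_eq_single (⟨k + 1, by omega⟩ : Fin n)]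
          · simp
          · intro b _ hb
            rw [if_neg fun h => hb (Fin.ext h), zero_mul]
          · simp
      rw [h1, h2, h3, h4, absorption_braidStrand he hn]
      simp_rw [overRow_step (n := n) (T : R) k (by omega)]
      simp only [Units.val_one, zpow_one, add_mul, Finset.sum_add_distrib, mul_assoc,
        ← Finset.mul_sum]
      rw [add_comm]
      congr 2
      rw [Finset.sum_eq_single (⟨k, by omega⟩ : Fin n)]
      · simp
      · intro b _ hb
        rw [if_neg fun h => hb (Fin.ext h), zero_mul]
      · simp
  · rintro ⟨⟨r, k⟩, b⟩ ⟨⟨r', k'⟩, b'⟩ h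
    have hlt : ∀ p, braidStrand e m (r + 1) p = some (Sum.inr (r', k'), b') →
        (r : ℕ) * n + k < r' * n + k' := by
      intro p hp
      rw [braidStrand_eq_some_inr hp, Nat.succ_mul]
      omega
    have hnext : (insertRows D e m).next (Sum.inr (r, k), b) = some (Sum.inr (r', k'), b') ∨
        (insertRows D e m).next (Sum.inr (r, k), false) = some (Sum.inr (r', k'), b') := by
      by_contra! hne
      refine h ?_
      rcases b with _ | _
      · exact Matrix.one_apply_ne hne.1
      · have e1 := Matrix.one_apply_ne (α := R) hne.1
        have e2 := Matrix.one_apply_ne (α := R) hne.2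
        change _ * (1 : Matrix _ _ R) _ (some (Sum.inr (r', k'), b')) + _ *
          (1 : Matrix _ _ R) _ (some (Sum.inr (r', k'), b')) = 0
        rw [e1, e2]
        simp
    have hfalse : (insertRows D e m).next (Sum.inr (r, k), false) = some (Sum.inr (r', k'), b') →
        (r : ℕ) * n + k < r' * n + k' := fun h => hlt _ h
    rcases hnext with h1 | h1
    · rcases b with _ | _
      · exact hfalse h1
      · simp only [insertRows] at h1
        split_ifs at h1 with hk
        · simp only [Option.some.injEq, Prod.mk.injEq, Sum.inr.injEq] at h1
          rw [← h1.1.1, ← h1.1.2]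
          simp
        · exact hlt _ h1
    · exact hfalse h1

end Elimination

/-! ### The chain with an infinite twist vertex -/

theorem sum_outer_eq_bandMatrix {R : Type*} [CommRing R] {n : ℕ} {e : Fin n → Strand C}
    (he : Function.Injective e) (Q : Matrix (Fin n) (Fin n) R) (s z : Strand C) :
    Sum.elim ((1 : Matrix (Strand C) (Strand C) R)) (fun p => bandMatrix e Q (e p))
      (Function.extend e Sum.inr Sum.inl s) z = bandMatrix e Q s z := by
  by_cases hs : ∃ p, e p = s
  · obtain ⟨p, rfl⟩ := hs
    rw [he.extend_apply]
    rfl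
  · rw [Function.extend_apply' _ _ _ hs, bandMatrix_apply_of_notMem _ hs]
    rfl

/-- The variable of the field of rational functions as a unit. -/
noncomputable def unitX : (RatFunc ℚ)ˣ := Units.mk0 RatFunc.X RatFunc.X_ne_zero

/-- Eliminating the n strands that enter the vertex composes its weights with the step before. No
entering strand leads to another one, so a constant height suffices. -/
theorem det_one_sub_infiniteTwistMatrix [Fintype C] (D : LongDiagram C) {n : ℕ}
    {e : Fin n → Strand C} (he : Function.Injective e) :
    (1 - D.infiniteTwistMatrix e).det = D.bandDet unitX e
      ((∑ i ∈ Finset.range n, (RatFunc.X : RatFunc ℚ) ^ i)⁻¹ • geomMatrix RatFunc.X) := by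
  set Q : Matrix (Fin n) (Fin n) (RatFunc ℚ) :=
    (∑ i ∈ Finset.range n, (RatFunc.X : RatFunc ℚ) ^ i)⁻¹ • geomMatrix RatFunc.X with hQ
  set V : Matrix (Strand C ⊕ Fin n) (Strand C) (RatFunc ℚ) := Matrix.of
    (Sum.elim (1 : Matrix (Strand C) (Strand C) (RatFunc ℚ)) fun p => bandMatrix e Q (e p)) with hV
  have hVs : ∀ v z, V (D.outerNext e v) z = bandMatrix e Q (D.next v) z := fun v z =>
    sum_outer_eq_bandMatrix he Q _ z
  rw [det_one_sub_eliminate (Equiv.refl _) _ V (fun z => rfl) ?_ (fun _ => 0) ?_, bandDet]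
  · congr 2
    ext s z
    rcases s with _ | ⟨c, _ | _⟩
    · rw [transition_mul_none]
      simp [Matrix.mul_apply, infiniteTwistMatrix]
    · rw [transition_mul_under, ← hVs]
      simp [Matrix.mul_apply, infiniteTwistMatrix]
    · rw [transition_mul_over, ← hVs, ← hVs]
      simp only [Matrix.mul_apply, infiniteTwistMatrix, Matrix.submatrix_apply, id,
        Function.comp_apply, Equiv.refl_apply, Matrix.of_apply, add_mul, ite_mul, zero_mul,
        Finset.sum_add_distrib, Finset.sum_ite_eq', Finset.mem_univ, if_true,
        Units.val_zpow_eq_zpow_val]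
      rfl
  · intro p
    ext z
    have h1 : V (Equiv.refl _ (Sum.inr p)) z = bandMatrix e Q (e p) z := rfl
    rw [h1, bandMatrix_apply_band he]
    simp only [Matrix.mul_apply, infiniteTwistMatrix, Equiv.refl_apply, Matrix.of_apply,
      Finset.sum_mul, ite_mul, zero_mul]
    rw [Finset.sum_comm]
    refine Finset.sum_congr rfl fun q _ => ?_
    rw [Finset.sum_ite_eq' Finset.univ, if_pos (Finset.mem_univ _)]
    have h2 : V (Sum.inl (e q)) z = (1 : Matrix (Strand C) (Strand C) (RatFunc ℚ)) (e q) z := rfl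
    rw [h2, hQ, Matrix.smul_apply, smul_eq_mul, div_eq_inv_mul]
    rfl
  · intro p q h
    simp [infiniteTwistMatrix] at h

end LongDiagram

end TwistedKnots

namespace TwistedKnots

namespace LongDiagram

/-! ### The order of the strands along the knot -/

section Order

variable {C : Type*} [Fintype C] {D : LongDiagram C}

/-- The place of a strand along the knot. -/
noncomputable def rank (hD : D.IsLongKnot) (s : Strand C) : ℕ :=
  ((Equiv.ofBijective _ hD).symm s : ℕ)

theorem iterate_rank (hD : D.IsLongKnot) (s : Strand C) : D.succ^[rank hD s] D.first = s :=
  (Equiv.ofBijective _ hD).apply_symm_apply s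

theorem rank_lt_card (hD : D.IsLongKnot) (s : Strand C) : rank hD s < Fintype.card (Strand C) :=
  ((Equiv.ofBijective _ hD).symm s).2

theorem rank_iterate (hD : D.IsLongKnot) {k : ℕ} (hk : k < Fintype.card (Strand C)) :
    rank hD (D.succ^[k] D.first) = k :=
  congrArg Fin.val ((Equiv.ofBijective _ hD).symm_apply_apply ⟨k, hk⟩)

theorem rank_injective (hD : D.IsLongKnot) : Function.Injective (rank hD) := fun s s' h => by
  rw [← iterate_rank hD s, h, iterate_rank hD s']

theorem iterate_eq_iterate_first (hD : D.IsLongKnot) (k : ℕ) (s : Strand C) :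
    D.succ^[k] s = D.succ^[k + rank hD s] D.first := by
  rw [Function.iterate_add_apply, iterate_rank]

theorem succ_iterate_none {C : Type*} {D : LongDiagram C} (k : ℕ) : D.succ^[k] none = none :=
  Function.iterate_fixed rfl k

/-- `succ` fixes `none`, so a further place after `none` would be occupied by `none` again. -/
theorem rank_none (hD : D.IsLongKnot) : rank hD none + 1 = Fintype.card (Strand C) := by
  by_contra h
  have hlt := rank_lt_card hD none
  have h1 : rank hD none + 1 < Fintype.card (Strand C) := by omega
  have h2 := rank_iterate hD h1
  rw [Function.iterate_succ_apply', iterate_rank] at h2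
  change rank hD none = _ at h2
  omega

theorem rank_some_lt (hD : D.IsLongKnot) (v : Passage C) :
    rank hD (some v) + 1 < Fintype.card (Strand C) := by
  have h1 := rank_lt_card hD (some v)
  have h2 := rank_none hD
  have h3 : rank hD (some v) ≠ rank hD none := fun h => by
    simpa using rank_injective hD h
  omega

theorem rank_next (hD : D.IsLongKnot) (v : Passage C) :
    rank hD (D.next v) = rank hD (some v) + 1 := by
  have h2 := rank_iterate hD (rank_some_lt hD v)
  rw [Function.iterate_succ_apply', iterate_rank] at h2
  exact h2

theorem before_iff_rank_lt (hD : D.IsLongKnot) (v w : Passage C) :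
    D.Before v w ↔ rank hD (some v) < rank hD (some w) := by
  constructor
  · rintro ⟨k, hk⟩
    by_cases hlt : (k + 1) + rank hD (some v) < Fintype.card (Strand C)
    · have := rank_iterate hD hlt
      rw [Function.iterate_add_apply, iterate_rank, hk] at this
      omega
    · exfalso
      have h1 := rank_none hD
      have h2 := rank_some_lt hD v
      -- An iteration that runs past the end has become stuck at `none` and cannot be at the passage
      -- `w`.
      obtain ⟨j, hj⟩ : ∃ j, k + 1 = j + (rank hD none - rank hD (some v)) :=
        ⟨k + 1 - (rank hD none - rank hD (some v)), by omega⟩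
      have h3 : D.succ^[rank hD none - rank hD (some v)] (some v) = none := by
        rw [iterate_eq_iterate_first hD,
          show rank hD none - rank hD (some v) + rank hD (some v) = rank hD none by omega,
          iterate_rank]
      rw [hj, Function.iterate_add_apply, h3, succ_iterate_none] at hk
      simp at hk
  · intro h
    refine ⟨rank hD (some w) - rank hD (some v) - 1, ?_⟩
    rw [iterate_eq_iterate_first hD,
      show rank hD (some w) - rank hD (some v) - 1 + 1 + rank hD (some v) = rank hD (some w) by
        omega, iterate_rank]

end Order

/-! ### The walk at `T = 1` -/

section Band

variable {C : Type*} [DecidableEq C] {R : Type*} [CommRing R]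

/-- The inclusion of the band in the set of strands, as a matrix. -/
def bandInclusion {n : ℕ} (e : Fin n → Strand C) (R : Type*) [CommRing R] :
    Matrix (Strand C) (Fin n) R :=
  Matrix.of fun s p => (1 : Matrix (Strand C) (Strand C) R) (e p) s

/-- This form is affine in `Q`, and its deviation from the identity factors through the n band
strands, which permits the reduction to n × n matrices. -/
theorem bandMatrix_eq {n : ℕ} {e : Fin n → Strand C} (he : Function.Injective e)
    (Q : Matrix (Fin n) (Fin n) R) :
    bandMatrix e Q = 1 + bandInclusion e R * (Q - 1) * (bandInclusion e R).transpose := by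
  have key : ∀ s z, (bandInclusion e R * (Q - 1) * (bandInclusion e R).transpose :
      Matrix (Strand C) (Strand C) R) s z
      = ∑ p, (1 : Matrix (Strand C) (Strand C) R) (e p) s *
        ∑ q, (Q - 1) p q * (1 : Matrix (Strand C) (Strand C) R) (e q) z := by
    intro s z
    rw [Matrix.mul_assoc, Matrix.mul_apply]
    simp [bandInclusion, Matrix.mul_apply]
  ext s z
  rw [Matrix.add_apply, key]
  by_cases hs : ∃ p, e p = s
  · obtain ⟨p, rfl⟩ := hs
    have h1 : ∑ p', (1 : Matrix (Strand C) (Strand C) R) (e p') (e p) *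
        ∑ q, (Q - 1) p' q * (1 : Matrix (Strand C) (Strand C) R) (e q) z
        = ∑ q, (Q - 1) p q * (1 : Matrix (Strand C) (Strand C) R) (e q) z := by
      rw [Finset.sum_eq_single p]
      · rw [Matrix.one_apply_eq, one_mul]
      · intro q _ hq
        rw [Matrix.one_apply_ne (he.ne hq), zero_mul]
      · simp
    rw [bandMatrix_apply_band he, h1]
    simp only [Matrix.sub_apply, sub_mul, Finset.sum_sub_distrib]
    simp [Matrix.one_apply (n := Fin n)]
  · rw [bandMatrix_apply_of_notMem _ hs, Finset.sum_eq_zero, add_zero]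
    intro p _
    rw [Matrix.one_apply_ne fun h => hs ⟨p, h⟩, zero_mul]

end Band

section Classical

variable {C : Type*} [Fintype C] [DecidableEq C] {D : LongDiagram C} {R : Type*} [CommRing R]

/-- The strands that follow a given one in the weak order along the knot. -/
noncomputable def reach (hD : D.IsLongKnot) (R : Type*) [CommRing R] :
    Matrix (Strand C) (Strand C) R :=
  Matrix.of fun a b => if rank hD a ≤ rank hD b then 1 else 0

/-- The strands that follow a given one in the strict order along the knot. -/
noncomputable def reachAfter (hD : D.IsLongKnot) (R : Type*) [CommRing R] :
    Matrix (Strand C) (Strand C) R :=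
  Matrix.of fun a b => if rank hD a < rank hD b then 1 else 0

/-- At T = 1 there are no jumps: one step leads to the next strand, and lying weakly after that one
means lying strictly after the present one. -/
theorem transition_one_mul_reach (hD : D.IsLongKnot) :
    D.transition (1 : Rˣ) * reach hD R = reachAfter hD R := by
  ext s z
  rcases s with _ | ⟨c, _ | _⟩
  · rw [transition_mul_none]
    have h1 := rank_none hD
    have h2 := rank_lt_card hD z
    simp [reachAfter]
    omega
  · rw [transition_mul_under]
    simp [reach, reachAfter, rank_next]
  · rw [transition_mul_over]
    simp [reach, reachAfter, rank_next]

theorem one_sub_transition_one_mul_reach (hD : D.IsLongKnot) :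
    (1 - D.transition (1 : Rˣ)) * reach hD R = 1 := by
  rw [sub_mul, one_mul, transition_one_mul_reach]
  ext a b
  simp only [reach, reachAfter, Matrix.sub_apply, Matrix.of_apply, Matrix.one_apply]
  rcases lt_trichotomy (rank hD a) (rank hD b) with h | h | h
  · rw [if_pos h.le, if_pos h, if_neg (by rintro rfl; omega), sub_self]
  · rw [if_pos h.le, if_neg h.not_lt, if_pos (rank_injective hD h), sub_zero]
  · rw [if_neg (by omega), if_neg (by omega), if_neg (by rintro rfl; omega), sub_zero]

theorem det_one_sub_transition_one (hD : D.IsLongKnot) :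
    (1 - D.transition (1 : Rˣ)).det = 1 := by
  refine det_one_sub_of_height _ (rank hD) fun a b h => ?_
  by_contra hab
  refine h ?_
  rcases a with _ | ⟨c, _ | _⟩
  · rfl
  · have : D.next (c, false) ≠ b := by
      rintro rfl
      rw [rank_next] at hab
      omega
    exact Matrix.one_apply_ne this
  · have : D.next (c, true) ≠ b := by
      rintro rfl
      rw [rank_next] at hab
      omega
    simp [transition, Matrix.one_apply_ne this]

theorem reach_mul_transition_one (hD : D.IsLongKnot) :
    reach hD R * D.transition (1 : Rˣ) = reachAfter hD R := by
  have h1 := one_sub_transition_one_mul_reach (R := R) hD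
  have h2 := mul_eq_one_comm.1 h1
  have h3 := transition_one_mul_reach (R := R) hD
  rw [sub_mul, one_mul, h3] at h1
  rw [mul_sub, mul_one] at h2
  rw [← sub_eq_zero, ← sub_eq_zero_of_eq (h1.trans h2.symm)]
  abel

/-- `det (1 - A) = det (1 - G (A - A₁))` where `A₁` is the transition matrix at `T = 1` and `G` is
the inverse of `1 - A₁`. -/
theorem det_one_sub_eq_det_one_sub_reach_mul (hD : D.IsLongKnot)
    (A : Matrix (Strand C) (Strand C) R) :
    (1 - A).det = (1 - reach hD R * (A - D.transition 1)).det := by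
  have h1 := mul_eq_one_comm.1 (one_sub_transition_one_mul_reach (R := R) hD)
  have h2 : 1 - reach hD R * (A - D.transition 1) = reach hD R * (1 - A) := by
    have h2 := h1
    rw [mul_sub, mul_one] at h2
    rw [mul_sub, mul_sub, mul_one, ← h2]
    abel
  have h3 := congrArg Matrix.det h1
  rw [Matrix.det_mul, det_one_sub_transition_one hD, mul_one, Matrix.det_one] at h3
  rw [h2, Matrix.det_mul, h3, one_mul]

/-- The strict order along the knot on the strands of the band. -/
noncomputable def bandAfter (hD : D.IsLongKnot) {n : ℕ} (e : Fin n → Strand C) (R : Type*)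
    [CommRing R] : Matrix (Fin n) (Fin n) R :=
  Matrix.of fun p q => if rank hD (e p) < rank hD (e q) then 1 else 0

theorem bandInclusion_transpose_mul_reachAfter_mul (hD : D.IsLongKnot) {n : ℕ}
    (e : Fin n → Strand C) :
    (bandInclusion e R).transpose * reachAfter hD R * bandInclusion e R = bandAfter hD e R := by
  have h1 : ∀ (M : Matrix (Strand C) (Strand C) R) p z,
      ((bandInclusion e R).transpose * M) p z = M (e p) z := by
    intro M p z
    simp [Matrix.mul_apply, bandInclusion, Matrix.one_apply, -Fintype.sum_option]
  have h2 : ∀ (M : Matrix (Fin n) (Strand C) R) p q,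
      (M * bandInclusion e R) p q = M p (e q) := by
    intro M p z
    simp [Matrix.mul_apply, bandInclusion, Matrix.one_apply, -Fintype.sum_option]
  ext p q
  rw [h2, h1]
  rfl

/-- By det (1 - XY) = det (1 - YX) the determinant is taken over the band only. At T = 1 all that
remains of the diagram is the order in which the knot runs through the band. -/
theorem bandDet_one (hD : D.IsLongKnot) {n : ℕ} {e : Fin n → Strand C}
    (he : Function.Injective e) (Q : Matrix (Fin n) (Fin n) R) :
    D.bandDet 1 e Q = (1 - (Q - 1) * bandAfter hD e R).det := by
  rw [bandDet, det_one_sub_eq_det_one_sub_reach_mul hD, bandMatrix_eq he]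
  have h1 : reach hD R * (D.transition 1 * (1 + bandInclusion e R * (Q - 1) *
      (bandInclusion e R).transpose) - D.transition 1)
      = (reachAfter hD R * bandInclusion e R) * ((Q - 1) * (bandInclusion e R).transpose) := by
    rw [mul_add, mul_one, add_sub_cancel_left, ← reach_mul_transition_one]
    simp only [Matrix.mul_assoc]
  rw [h1, Matrix.det_one_sub_mul_comm, Matrix.mul_assoc, ← Matrix.mul_assoc _ (reachAfter hD R),
    bandInclusion_transpose_mul_reachAfter_mul]

end Classical

end LongDiagram

end TwistedKnots

namespace TwistedKnots

/-! ### Turning number, writhe, and values at T = 1 -/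

namespace LongDiagram

variable {C : Type*}

open Classical in
/-- The sum of the signs of the crossings whose first passage is the lower one. -/
noncomputable def underFirst [Fintype C] (D : LongDiagram C) : ℤ :=
  ∑ c, if D.Before (c, false) (c, true) then (D.sign c : ℤ) else 0

/-- A crossing whose under-passage comes first contributes twice its sign; otherwise its two
contributions cancel. -/
theorem turningNumber_add_writhe [Fintype C] (D : LongDiagram C) :
    D.turningNumber + D.writhe = 2 * D.underFirst := by
  classical
  rw [turningNumber, writhe, underFirst, ← Finset.sum_add_distrib, Finset.mul_sum]
  refine Finset.sum_congr rfl fun c _ => ?_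
  split_ifs <;> ring

variable [Fintype C] [DecidableEq C] {D : LongDiagram C}

/-! ### The value at `T = 1` of the chain with an infinite twist vertex -/

/-- The rank orders the band strands totally, so each unordered pair is counted exactly once. -/
theorem sum_bandAfter (hD : D.IsLongKnot) {n : ℕ} {e : Fin n → Strand C}
    (he : Function.Injective e) (R : Type*) [CommRing R] :
    ∑ p, ∑ q, bandAfter hD e R p q = ((n * (n - 1) / 2 : ℕ) : R) := by
  have hcast : ∑ p, ∑ q, bandAfter hD e R p q = ((∑ p, ∑ q, bandAfter hD e ℤ p q : ℤ) : R) := by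
    simp [bandAfter]
  have hsymm : ∀ q p : Fin n, bandAfter hD e ℤ p q + bandAfter hD e ℤ q p
      = 1 - if q = p then 1 else 0 := by
    intro q p
    simp only [bandAfter, Matrix.of_apply]
    rcases lt_trichotomy (rank hD (e p)) (rank hD (e q)) with h | h | h
    · rw [if_pos h, if_neg h.not_gt, if_neg (by rintro rfl; omega)]; rfl
    · rw [if_neg (by omega), if_neg (by omega), if_pos (he (rank_injective hD h.symm))]; rfl
    · rw [if_neg h.not_gt, if_pos h, if_neg (by rintro rfl; omega)]; rfl
  have hcomm : ∑ p, ∑ q, bandAfter hD e ℤ p q = ∑ q, ∑ p, bandAfter hD e ℤ p q :=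
    Finset.sum_comm
  have hsum : ∑ p, ∑ q, bandAfter hD e ℤ p q + ∑ p, ∑ q, bandAfter hD e ℤ p q
      = (n : ℤ) * n - n := by
    refine (congrArg (· + _) hcomm).trans ?_
    simp only [← Finset.sum_add_distrib, hsymm]
    simp
  have hdiv : n * (n - 1) / 2 * 2 = n * (n - 1) :=
    Nat.div_mul_cancel (Nat.even_mul_pred_self n).two_dvd
  have hmul : ((n * (n - 1) : ℕ) : ℤ) = (n : ℤ) * n - n := by
    rcases n with _ | n
    · simp
    · push_cast [Nat.succ_sub_one]; ring
  generalize n * (n - 1) / 2 = m at hdiv ⊢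
  have hm : ((m * 2 : ℕ) : ℤ) = (n : ℤ) * n - n := hdiv ▸ hmul
  rw [hcast, show (∑ p, ∑ q, bandAfter hD e ℤ p q : ℤ) = (m : ℤ) by push_cast at hm; omega]
  simp

/-- Let J be the all-ones matrix and m the band strand that is last along the knot. Column m of 1 +
L consists of ones, so 1 + L - JL/n is the unimodular 1 + L times a rank-one perturbation of the
identity. Its determinant is 1 minus 1/n times the sum n - 1 of column m of L. -/
theorem bandDet_one_geomMatrix (hD : D.IsLongKnot) {n : ℕ} (hn : 0 < n) {e : Fin n → Strand C}
    (he : Function.Injective e) :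
    D.bandDet (1 : ℚˣ) e ((n : ℚ)⁻¹ • geomMatrix 1) = 1 / n := by
  have hn0 : (n : ℚ) ≠ 0 := by exact_mod_cast hn.ne'
  rw [bandDet_one hD he]
  set L := bandAfter hD e ℚ with hL
  obtain ⟨m, -, hm⟩ := Finset.exists_max_image Finset.univ (fun p => rank hD (e p))
    ⟨⟨0, hn⟩, Finset.mem_univ _⟩
  have hm' : ∀ p, p ≠ m → rank hD (e p) < rank hD (e m) := fun p hp =>
    lt_of_le_of_ne (hm p (Finset.mem_univ _)) fun h => hp (he (rank_injective hD h))
  have hLm : ∀ p, L p m = if p = m then 0 else 1 := by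
    intro p
    by_cases hp : p = m
    · subst hp; simp [hL, bandAfter]
    · simp [hL, bandAfter, hm' p hp, hp]
  have hdet : (1 + L).det = 1 := by
    rw [← sub_neg_eq_add]
    refine det_one_sub_of_height _ (fun p => rank hD (e p)) fun p q h => ?_
    by_contra hlt
    exact h (by simp [hL, bandAfter, hlt])
  have hfac : 1 - ((n : ℚ)⁻¹ • geomMatrix 1 - 1) * L = (1 + L) *
      (1 + Matrix.replicateCol Unit (fun p => if p = m then -(n : ℚ)⁻¹ else 0) *
        Matrix.replicateRow Unit fun q => ∑ p, L p q) := by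
    have hkey : (1 + L) * (Matrix.replicateCol Unit (fun p => if p = m then -(n : ℚ)⁻¹ else 0) *
        Matrix.replicateRow Unit fun q => ∑ p, L p q) = -((n : ℚ)⁻¹ • geomMatrix 1 * L) := by
      rw [← Matrix.mul_assoc]
      ext p q
      simp only [Matrix.mul_apply, geomMatrix, Matrix.add_apply, Matrix.one_apply, hLm,
        Matrix.replicateCol_apply, Matrix.replicateRow_apply, Matrix.neg_apply, Matrix.smul_apply,
        Matrix.of_apply, Finset.univ_unique, Finset.sum_singleton, mul_ite, mul_zero,
        Finset.sum_ite_eq', Finset.mem_univ, if_true, one_pow, smul_eq_mul, mul_one,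
        ← Finset.mul_sum]
      split_ifs <;> ring
    rw [mul_add, mul_one, hkey, sub_mul, one_mul]
    abel
  rw [hfac, Matrix.det_mul, hdet, one_mul, Matrix.det_one_add_replicateCol_mul_replicateRow]
  simp only [dotProduct, mul_ite, mul_zero, Finset.sum_ite_eq', Finset.mem_univ, if_true, hLm]
  simp only [Finset.sum_ite, Finset.sum_const_zero, zero_add, Finset.sum_const]
  rw [Finset.filter_not, Finset.filter_eq' , if_pos (Finset.mem_univ _),
    Finset.card_sdiff_of_subset (Finset.subset_univ _)]
  simp only [Finset.card_univ, Fintype.card_fin, Finset.card_singleton, nsmul_eq_mul, mul_one]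
  rw [Nat.cast_sub hn]
  field_simp
  simp

/-! ### The first-order behaviour at `T = 1` -/

section Infinitesimal

variable {R : Type*} [CommRing R]

/-- The unit `1 + ε`, where `ε ^ 2 = 0`. -/
def epsUnit (ε : R) (hε : ε * ε = 0) : Rˣ where
  val := 1 + ε
  inv := 1 - ε
  val_inv := by linear_combination -hε
  inv_val := by linear_combination -hε

theorem epsUnit_zpow (ε : R) (hε : ε * ε = 0) (k : ℤ) :
    ((epsUnit ε hε ^ k : Rˣ) : R) = 1 + k * ε := by
  induction k using Int.induction_on with
  | zero => simp
  | succ k ih =>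
    rw [zpow_add_one, Units.val_mul, ih]
    change _ * (1 + ε) = _
    push_cast
    linear_combination (k : R) * hε
  | pred k ih =>
    rw [zpow_sub_one, Units.val_mul, ih]
    change _ * (1 - ε) = _
    push_cast
    linear_combination (k : R) * hε

/-- The derivative at `T = 1` of the transition matrix. -/
def transitionDeriv (D : LongDiagram C) (R : Type*) [CommRing R] :
    Matrix (Strand C) (Strand C) R :=
  Matrix.of fun
    | some (c, true), s => ((D.sign c : ℤ) : R) *
        ((1 : Matrix (Strand C) (Strand C) R) (D.next (c, true)) s -
          (1 : Matrix (Strand C) (Strand C) R) (D.next (c, false)) s)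
    | _, _ => 0

theorem transition_epsUnit (D : LongDiagram C) (ε : R) (hε : ε * ε = 0) :
    D.transition (epsUnit ε hε) = D.transition 1 + ε • D.transitionDeriv R := by
  ext s z
  rcases s with _ | ⟨c, _ | _⟩
  · simp [transition, transitionDeriv]
  · simp [transition, transitionDeriv]
  · simp only [transition, transitionDeriv, Matrix.of_apply, Matrix.add_apply, Matrix.smul_apply,
      epsUnit_zpow, one_zpow, Units.val_one, smul_eq_mul]
    ring

/-- Only over-passages contribute. The strand after an over-passage never returns to it; the strand
after the under-passage leads to it exactly when the under-passage comes first. -/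
theorem trace_reach_mul_transitionDeriv (hD : D.IsLongKnot) :
    (reach hD R * D.transitionDeriv R).trace = -(D.underFirst : R) := by
  rw [Matrix.trace_mul_comm, Matrix.trace, Fintype.sum_option, Fintype.sum_prod_type, underFirst,
    Int.cast_sum, ← Finset.sum_neg_distrib]
  have h0 : (D.transitionDeriv R * reach hD R).diag none = 0 := by
    simp [Matrix.mul_apply, transitionDeriv]
  rw [h0, zero_add]
  refine Finset.sum_congr rfl fun c _ => ?_
  have h1 : (D.transitionDeriv R * reach hD R).diag (some (c, false)) = 0 := by
    simp [Matrix.mul_apply, transitionDeriv]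
  have h2 : (D.transitionDeriv R * reach hD R).diag (some (c, true)) = ((D.sign c : ℤ) : R) *
      (reach hD R (D.next (c, true)) (some (c, true)) -
        reach hD R (D.next (c, false)) (some (c, true))) := by
    simp [Matrix.mul_apply, transitionDeriv, Matrix.one_apply, mul_assoc, sub_mul,
      -Fintype.sum_option, ← Finset.mul_sum]
  rw [Fintype.sum_bool, h1, h2, add_zero]
  simp only [reach, Matrix.of_apply, rank_next, before_iff_rank_lt hD, Nat.succ_le_iff,
    lt_irrefl, if_false]
  split_ifs <;> simp

/-- To first order the determinant is 1 minus a trace, which splits into a contribution of the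
crossings of `D` and one of the twists. This is the exponent needed for the symmetric normalization.
-/
theorem bandDet_epsUnit (hD : D.IsLongKnot) {n : ℕ} {e : Fin n → Strand C}
    (he : Function.Injective e) (ε : R) (hε : ε * ε = 0) (t : ℕ) :
    D.bandDet (epsUnit ε hε) e (rowMatrix (1 + ε) ^ (t * n))
      = 1 + (D.underFirst + (t : ℤ) * (n * (n - 1) / 2 : ℕ) : ℤ) * ε := by
  have hpow : ∀ k : ℕ, (1 + ε) ^ k = 1 + k * ε := by
    intro k
    have := epsUnit_zpow ε hε k
    rw [zpow_natCast, Units.val_pow_eq_pow_val] at this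
    simpa [epsUnit] using this
  have heps : ∀ x : R, ε * (1 + x * ε) = ε := fun x => by linear_combination x * hε
  set J : Matrix (Fin n) (Fin n) R := Matrix.of fun _ _ => 1 with hJ
  set N : Matrix (Fin n) (Fin n) R := (t : R) • ((n : R) • (1 : Matrix (Fin n) (Fin n) R) - J)
    with hN
  -- The factor 1 - T is -ε, so the geometric sum and the entries of `geomMatrix` count only with
  -- their values at T = 1.
  have hQ : (rowMatrix (1 + ε) : Matrix (Fin n) (Fin n) R) ^ (t * n) = 1 + ε • N := by
    rw [rowMatrix_pow_mul]
    ext p q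
    simp only [hpow, hN, hJ, geomMatrix, Matrix.add_apply, Matrix.smul_apply, Matrix.sub_apply,
      Matrix.of_apply, smul_eq_mul]
    have h1 : (1 - (1 + ε)) * (∑ i ∈ Finset.range t, (1 + ((i * n : ℕ) : R) * ε))
        * (1 + ((q : ℕ) : R) * ε) = -(t * ε) := by
      have h2 : ∑ i ∈ Finset.range t, ε * (1 + ((i * n : ℕ) : R) * ε) = t * ε := by
        simp [heps]
      rw [← Finset.mul_sum] at h2
      linear_combination (-(1 + ((q : ℕ) : R) * ε)) * h2 - t * heps ((q : ℕ) : R)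
    rw [h1]
    push_cast
    ring
  have hA : D.transition (epsUnit ε hε) * bandMatrix e (1 + ε • N) - D.transition 1
      = ε • (D.transitionDeriv R +
        D.transition 1 * (bandInclusion e R * N * (bandInclusion e R).transpose)) := by
    rw [transition_epsUnit, bandMatrix_eq he, add_sub_cancel_left, Matrix.mul_smul,
      Matrix.smul_mul, add_mul, mul_add, mul_add]
    simp only [mul_one, Matrix.mul_smul, Matrix.smul_mul, smul_smul, hε, zero_smul, smul_add]
    abel
  -- The strict order has zero diagonal, so the scalar part of `N` drops out; the trace against `J`
  -- is the sum of all entries.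
  have htr : (bandAfter hD e R * N).trace = -((t : R) * (n * (n - 1) / 2 : ℕ)) := by
    rw [hN, Matrix.mul_smul, Matrix.trace_smul, mul_sub, Matrix.mul_smul, mul_one,
      Matrix.trace_sub, Matrix.trace_smul, ← sum_bandAfter hD he]
    simp [Matrix.trace, Matrix.mul_apply, hJ, bandAfter]
  rw [hQ, bandDet, det_one_sub_eq_det_one_sub_reach_mul hD, hA, Matrix.mul_smul,
    det_one_sub_eps_smul ε hε, mul_add, Matrix.trace_add, trace_reach_mul_transitionDeriv,
    ← Matrix.mul_assoc, reach_mul_transition_one, Matrix.mul_assoc (bandInclusion e R),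
    ← Matrix.mul_assoc (reachAfter hD R), Matrix.trace_mul_comm, Matrix.mul_assoc N,
    ← Matrix.mul_assoc _ (reachAfter hD R), bandInclusion_transpose_mul_reachAfter_mul,
    Matrix.trace_mul_comm, htr]
  generalize n * (n - 1) / 2 = m
  push_cast
  ring

end Infinitesimal

end LongDiagram

end TwistedKnots

namespace TwistedKnots

/-! ### Laurent polynomials -/

/-- Clearing negative powers turns a unit and its inverse into polynomials with product X^(a+b).
Since X is prime in ℤ[X], each is a power of X up to sign. -/
theorem exists_eq_T_or_neg_T_of_isUnit {u : ℤ[T;T⁻¹]} (hu : IsUnit u) :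
    ∃ k : ℤ, u = LaurentPolynomial.T k ∨ u = -LaurentPolynomial.T k := by
  obtain ⟨v, huv⟩ := hu.exists_right_inv
  obtain ⟨a, p, hp⟩ := LaurentPolynomial.exists_T_pow u
  obtain ⟨b, q, hq⟩ := LaurentPolynomial.exists_T_pow v
  have hpq : p * q = Polynomial.X ^ (a + b) := by
    apply Polynomial.toLaurent_injective
    rw [map_mul, hp, hq, Polynomial.toLaurent_X_pow, Nat.cast_add, LaurentPolynomial.T_add]
    linear_combination LaurentPolynomial.T (a : ℤ) * LaurentPolynomial.T (b : ℤ) * huv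
  obtain ⟨i, -, hi⟩ := (dvd_prime_pow Polynomial.prime_X _).1 (Dvd.intro _ hpq)
  obtain ⟨w, hw⟩ := hi.symm
  obtain ⟨r, hr, hrw⟩ := Polynomial.isUnit_iff.1 w.isUnit
  have hu' : u = Polynomial.toLaurent p * LaurentPolynomial.T (-a) := by
    rw [hp, mul_assoc, ← LaurentPolynomial.T_add]
    simp
  refine ⟨i + -a, ?_⟩
  rw [hu', ← hw, ← hrw, map_mul, Polynomial.toLaurent_X_pow, Polynomial.toLaurent_C,
    LaurentPolynomial.T_add]
  rcases Int.isUnit_iff.1 hr with rfl | rfl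
  · left; rw [map_one, mul_one]
  · right; rw [map_neg, map_one]; ring

section DualNumbers

/-- The expansion to first order at `T = 1`. -/
noncomputable def firstOrder : ℤ[T;T⁻¹] →+* DualNumber ℤ :=
  LaurentPolynomial.eval₂ (Int.castRingHom _)
    (LongDiagram.epsUnit (DualNumber.eps : DualNumber ℤ) (DualNumber.eps_mul_eps))

theorem firstOrder_T (k : ℤ) :
    firstOrder (LaurentPolynomial.T k) = 1 + k * (DualNumber.eps : DualNumber ℤ) := by
  rw [firstOrder, LaurentPolynomial.eval₂_T]
  exact LongDiagram.epsUnit_zpow _ _ _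

theorem firstOrder_add_firstOrder_invert (f : ℤ[T;T⁻¹]) :
    firstOrder f + firstOrder (LaurentPolynomial.invert f)
      = ((2 * LaurentPolynomial.eval₂ (RingHom.id ℤ) (1 : ℤˣ) f : ℤ) : DualNumber ℤ) := by
  induction f using LaurentPolynomial.induction_on' with
  | add p q hp hq =>
    simp only [map_add, mul_add, Int.cast_add, ← hp, ← hq]
    ring
  | C_mul_T n a =>
    rw [map_mul, map_mul, LaurentPolynomial.invert_C, LaurentPolynomial.invert_T, map_mul,
      LaurentPolynomial.eval₂_C_mul_T, firstOrder_T, firstOrder_T]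
    simp only [firstOrder, LaurentPolynomial.eval₂_C]
    simp
    ring

/-- T^k and T^(-k) have opposite derivatives at 1, so symmetry forces f'(1) = 0. -/
theorem firstOrder_eq_one {f : ℤ[T;T⁻¹]} (hf : LaurentPolynomial.invert f = f)
    (h1 : LaurentPolynomial.eval₂ (RingHom.id ℤ) (1 : ℤˣ) f = 1) : firstOrder f = 1 := by
  have h := firstOrder_add_firstOrder_invert f
  rw [hf, h1] at h
  have hfst := congrArg TrivSqZeroExt.fst h
  have hsnd := congrArg TrivSqZeroExt.snd h
  rw [TrivSqZeroExt.fst_add, TrivSqZeroExt.fst_intCast] at hfst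
  rw [TrivSqZeroExt.snd_add, TrivSqZeroExt.snd_intCast] at hsnd
  ext
  · rw [TrivSqZeroExt.fst_one]
    simp only [Int.cast_id] at hfst
    omega
  · rw [TrivSqZeroExt.snd_one]
    omega

end DualNumbers

/-- The exponent of the symmetrized Alexander polynomial is the derivative at `T = 1`. -/
theorem LongDiagram.IsAlexanderPolynomial.eq_T_mul_det {C : Type*} [Fintype C] [DecidableEq C]
    {D : LongDiagram C} {f : ℤ[T;T⁻¹]} (hf : D.IsAlexanderPolynomial f) {s : ℤ}
    (hs : firstOrder (1 - D.transition unitT).det = 1 + s * (DualNumber.eps : DualNumber ℤ)) :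
    f = LaurentPolynomial.T (-s) * (1 - D.transition unitT).det := by
  obtain ⟨hspan, hinv, h1⟩ := hf
  rw [minorIdeal_alexanderMatrix, Ideal.span_singleton_eq_span_singleton] at hspan
  obtain ⟨u, hu⟩ := hspan
  have hone := firstOrder_eq_one hinv h1
  obtain ⟨k, hk | hk⟩ := exists_eq_T_or_neg_T_of_isUnit u.isUnit
  -- (1 + sε)(1 + kε) = 1 forces k = -s; with the other sign the constant term would be -1.
  · rw [← hu, map_mul, hs, hk, firstOrder_T] at hone
    have hsnd := congrArg TrivSqZeroExt.snd hone
    simp at hsnd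
    rw [← hu, hk, show k = -s by omega, mul_comm]
  · rw [← hu, map_mul, hs, hk, map_neg, firstOrder_T] at hone
    have hfst := congrArg TrivSqZeroExt.fst hone
    simp at hfst

/-! ### Expansions at `T = 0` -/

section Expansion

variable {K : Type*} [Field K]

open scoped RatFunc in
/-- The expansion of a rational function at `0`. -/
noncomputable def expansion : RatFunc K →+* LaurentSeries K :=
  algebraMap (RatFunc K) (LaurentSeries K)

theorem expansion_X : expansion (RatFunc.X : RatFunc K) = HahnSeries.single 1 1 :=
  RatFunc.coe_X

theorem expansion_X_zpow (k : ℤ) :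
    expansion (RatFunc.X ^ k : RatFunc K) = HahnSeries.single k 1 := by
  rw [map_zpow₀, expansion_X, ← RatFunc.single_zpow]

theorem coeff_expansion_algebraMap (q : Polynomial K) (i : ℕ) :
    (expansion (algebraMap (Polynomial K) (RatFunc K) q)).coeff i = q.coeff i := by
  change (((q : RatFunc K)) : LaurentSeries K).coeff i = q.coeff i
  rw [← RatFunc.coe_coe, LaurentSeries.coeff_coe_powerSeries, Polynomial.coeff_coe]

/-- The embedding of Laurent polynomials in the field of rational functions. -/
noncomputable def toRatFunc : ℤ[T;T⁻¹] →+* RatFunc K :=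
  LaurentPolynomial.eval₂ (Int.castRingHom _) (Units.mk0 RatFunc.X RatFunc.X_ne_zero)

theorem toRatFunc_T (k : ℤ) :
    toRatFunc (LaurentPolynomial.T k) = (RatFunc.X : RatFunc K) ^ k := by
  rw [toRatFunc, LaurentPolynomial.eval₂_T, Units.val_zpow_eq_zpow_val, Units.val_mk0]

theorem coeff_expansion_toRatFunc (p : ℤ[T;T⁻¹]) (r : ℤ) :
    (expansion (toRatFunc p : RatFunc K)).coeff r = ((p.coeff r : ℤ) : K) := by
  induction p using LaurentPolynomial.induction_on' with
  | add p q hp hq => simp [hp, hq]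
  | C_mul_T n a =>
    have ha : (LaurentPolynomial.C a : ℤ[T;T⁻¹]) = (a : ℤ[T;T⁻¹]) := by simp
    have hc : ((a : ℤ) : LaurentSeries K) = HahnSeries.C (a : K) := by simp
    rw [map_mul, map_mul, toRatFunc_T, expansion_X_zpow, HahnSeries.coeff_mul_single, mul_one, ha,
      map_intCast, map_intCast, hc, ← ha, ← LaurentPolynomial.single_eq_C_mul_T,
      AddMonoidAlgebra.coeff_single, HahnSeries.C_apply, HahnSeries.coeff_single, Finsupp.single_apply]
    by_cases h : r = n
    · subst h; simp
    · rw [if_neg (by omega), if_neg (by omega), Int.cast_zero]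

/-- Since `g` does not depend on t, its finitely many coefficients have bounded pole order at 0,
while the factor X^(tn) shifts them by at least t. -/
theorem exists_coeff_expansion_eq_zero {n : ℕ} (hn : 0 < n) (g : Polynomial (RatFunc K))
    (r₀ : ℤ) : ∃ t₀ : ℕ, ∀ t, t₀ ≤ t → ∀ r : ℤ, r ≤ r₀ →
      (expansion (RatFunc.X ^ (t * n) * g.eval (RatFunc.X ^ (t * n)))).coeff r = 0 := by
  induction g using Polynomial.induction_on' with
  | add p q hp hq =>
    obtain ⟨t₁, h₁⟩ := hp
    obtain ⟨t₂, h₂⟩ := hq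
    refine ⟨max t₁ t₂, fun t ht r hr => ?_⟩
    rw [Polynomial.eval_add, mul_add, map_add, HahnSeries.coeff_add,
      h₁ t (le_trans (le_max_left _ _) ht) r hr, h₂ t (le_trans (le_max_right _ _) ht) r hr,
      add_zero]
  | monomial j a =>
    refine ⟨(r₀ - (expansion a).order).toNat + 1, fun t ht r hr => ?_⟩
    have h1 : (RatFunc.X ^ (t * n) * (Polynomial.monomial j a).eval (RatFunc.X ^ (t * n)))
        = RatFunc.X ^ ((t * n * (j + 1) : ℕ) : ℤ) * a := by
      rw [Polynomial.eval_monomial, zpow_natCast]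
      ring
    rw [h1, map_mul, expansion_X_zpow, HahnSeries.coeff_single_mul, one_mul]
    apply HahnSeries.coeff_eq_zero_of_lt_order
    have h2 : t ≤ t * n * (j + 1) := by
      rw [mul_assoc]
      exact Nat.le_mul_of_pos_right _ (by positivity)
    have h3 : (t : ℤ) ≤ ((t * n * (j + 1) : ℕ) : ℤ) := by exact_mod_cast h2
    have h4 := Int.self_le_toNat (r₀ - (expansion a).order)
    omega

end Expansion

theorem HasStableLimit.stabilizesPositively {p : ℕ → ℤ[T;T⁻¹]} {L : LaurentSeries ℚ}
    (h : HasStableLimit p L) : StabilizesPositively p := by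
  intro r₀
  obtain ⟨t₀, ht₀⟩ := h r₀
  refine ⟨t₀, fun t ht r hr => ?_⟩
  have := (ht₀ t ht r hr).trans (ht₀ t₀ le_rfl r hr).symm
  exact_mod_cast this

/-! ### Rational functions that are regular at `1` -/

/-- The polynomials that do not vanish at `1`. -/
noncomputable def nonvanishing : Submonoid (Polynomial ℚ) :=
  (nonZeroDivisors ℚ).comap (Polynomial.evalRingHom 1)

theorem mem_nonvanishing {p : Polynomial ℚ} : p ∈ nonvanishing ↔ p.eval 1 ≠ 0 := by
  simp [nonvanishing]

/-- The ring of rational functions that are regular at `1`. -/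
abbrev RegularAtOne : Type := Localization nonvanishing

namespace RegularAtOne

/-- The value at `1`. -/
noncomputable def value : RegularAtOne →+* ℚ :=
  IsLocalization.lift (M := nonvanishing) (g := Polynomial.evalRingHom (1 : ℚ)) fun y =>
    IsUnit.mk0 _ (mem_nonvanishing.1 y.2)

/-- The inclusion in the field of rational functions. -/
noncomputable def toField : RegularAtOne →+* RatFunc ℚ :=
  IsLocalization.lift (M := nonvanishing) (g := algebraMap (Polynomial ℚ) (RatFunc ℚ)) fun y => by
    refine IsUnit.mk0 _ (RatFunc.algebraMap_ne_zero fun h => mem_nonvanishing.1 y.2 ?_)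
    rw [h, Polynomial.eval_zero]

theorem value_algebraMap (p : Polynomial ℚ) : value (algebraMap _ _ p) = p.eval 1 :=
  IsLocalization.lift_eq _ _

theorem toField_algebraMap (p : Polynomial ℚ) : toField (algebraMap _ _ p) = algebraMap _ _ p :=
  IsLocalization.lift_eq _ _

/-- The reduced denominator divides any denominator, in particular one that does not vanish at 1.
Regularity and the value at 1 can thus be computed in the localization. -/
theorem denom_and_eval (d : RegularAtOne) : (toField d).denom.eval 1 ≠ 0 ∧
    (toField d).eval (RingHom.id ℚ) 1 = value d := by
  obtain ⟨p, q, hd⟩ := IsLocalization.exists_mk'_eq nonvanishing d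
  have hq := mem_nonvanishing.1 q.2
  have hq0 : (q : Polynomial ℚ) ≠ 0 := fun h => hq (by rw [h, Polynomial.eval_zero])
  have hmul : d * algebraMap _ _ (q : Polynomial ℚ) = algebraMap _ _ p := by
    rw [← hd]
    exact IsLocalization.mk'_spec _ _ _
  have hF := congrArg toField hmul
  have hv := congrArg value hmul
  rw [map_mul, toField_algebraMap, toField_algebraMap] at hF
  rw [map_mul, value_algebraMap, value_algebraMap] at hv
  have hdiv : toField d = algebraMap _ _ p / algebraMap _ _ (q : Polynomial ℚ) :=
    eq_div_of_mul_eq (RatFunc.algebraMap_ne_zero hq0) hF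
  have hden : (toField d).denom.eval 1 ≠ 0 := by
    intro h0
    obtain ⟨c, hc⟩ := hdiv ▸ RatFunc.denom_div_dvd p (q : Polynomial ℚ)
    exact hq (by rw [hc, Polynomial.eval_mul, h0, zero_mul])
  refine ⟨hden, ?_⟩
  have h1 : (toField d).num * q = p * (toField d).denom := by
    apply RatFunc.algebraMap_injective ℚ
    have h2 := RatFunc.num_div_denom (toField d)
    rw [div_eq_iff (RatFunc.algebraMap_ne_zero (RatFunc.denom_ne_zero _))] at h2
    rw [map_mul, map_mul, h2, ← hF]
    ring
  have h2 := congrArg (Polynomial.eval 1) h1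
  rw [Polynomial.eval_mul, Polynomial.eval_mul, ← hv] at h2
  rw [RatFunc.eval, Polynomial.eval₂_id, Polynomial.eval₂_id, div_eq_iff hden]
  exact mul_right_cancel₀ hq (by linear_combination h2)

/-- The variable as a unit. -/
noncomputable def unitX : RegularAtOneˣ :=
  (IsLocalization.map_units RegularAtOne
    (⟨Polynomial.X, mem_nonvanishing.2 (by simp)⟩ : nonvanishing)).unit

theorem coe_unitX : (unitX : RegularAtOne) = algebraMap (Polynomial ℚ) _ Polynomial.X := rfl

theorem map_value_unitX : Units.map (value : RegularAtOne →* ℚ) unitX = 1 := by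
  ext
  simp [coe_unitX, value_algebraMap]

theorem map_toField_unitX :
    Units.map (toField : RegularAtOne →* RatFunc ℚ) unitX = LongDiagram.unitX := by
  ext
  simp [coe_unitX, toField_algebraMap, LongDiagram.unitX]

/-- The inverse of `1 + T + ⋯ + T ^ (n - 1)`. -/
theorem exists_geom_inverse {n : ℕ} (hn : 0 < n) : ∃ w : RegularAtOne,
    value w = (n : ℚ)⁻¹ ∧ toField w = (∑ i ∈ Finset.range n, (RatFunc.X : RatFunc ℚ) ^ i)⁻¹ := by
  have hn0 : (n : ℚ) ≠ 0 := by exact_mod_cast hn.ne'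
  have hs : (∑ i ∈ Finset.range n, (Polynomial.X : Polynomial ℚ) ^ i).eval 1 = n := by
    simp [Polynomial.eval_finsetSum]
  set q : nonvanishing := ⟨∑ i ∈ Finset.range n, Polynomial.X ^ i, mem_nonvanishing.2 (hs ▸ hn0)⟩
  obtain ⟨w, hw⟩ := (IsLocalization.map_units RegularAtOne q).exists_left_inv
  refine ⟨w, ?_, ?_⟩
  · have := congrArg value hw
    rw [map_mul, value_algebraMap, map_one] at this
    exact eq_inv_of_mul_eq_one_left (hs ▸ this)
  · have := congrArg toField hw
    rw [map_mul, toField_algebraMap, map_one] at this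
    refine eq_inv_of_mul_eq_one_left ?_
    simpa [q] using this

end RegularAtOne

end TwistedKnots

/-! ### Passage from finitely many twists to the infinite twist -/

namespace TwistedKnots

theorem rowMatrix_map {R R' : Type*} [CommRing R] [CommRing R'] (φ : R →+* R') (n : ℕ) (T : R) :
    (rowMatrix T : Matrix (Fin n) (Fin n) R).map φ = rowMatrix (φ T) := by
  ext p q
  simp [rowMatrix, overRow, apply_ite φ]

theorem geomMatrix_map {R R' : Type*} [CommRing R] [CommRing R'] (φ : R →+* R') (n : ℕ) (T : R) :
    (geomMatrix T : Matrix (Fin n) (Fin n) R).map φ = geomMatrix (φ T) := by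
  ext p q
  simp [geomMatrix]

/-- The Burau matrix of `t` full twists is a deformation of that of the infinite twist. -/
theorem rowMatrix_pow_eq_add_smul {R : Type*} [CommRing R] {n : ℕ} (T w : R)
    (hw : w * ∑ i ∈ Finset.range n, T ^ i = 1) (t : ℕ) :
    (rowMatrix T : Matrix (Fin n) (Fin n) R) ^ (t * n)
      = w • geomMatrix T + T ^ (t * n) • (1 - w • geomMatrix T) := by
  have h1 := mul_neg_geom_sum T n
  have h2 := mul_neg_geom_sum (T ^ n) t
  simp_rw [← pow_mul, mul_comm n] at h2
  -- Factor 1 - T^(tn) first through 1 - T^n, then through 1 - T; `w` removes the factor 1 + ⋯ +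
  -- T^(n-1).
  have h3 : (1 - T) * ∑ i ∈ Finset.range t, T ^ (i * n) = w * (1 - T ^ (t * n)) := by
    rw [← h2, ← h1]
    linear_combination (-(1 - T) * ∑ i ∈ Finset.range t, T ^ (i * n)) * hw
  rw [rowMatrix_pow_mul, h3, smul_sub, smul_smul, add_comm, add_sub, add_sub_right_comm, ← sub_smul]
  congr 2
  ring

namespace LongDiagram

variable {C : Type*} [Fintype C] [DecidableEq C] {n : ℕ} {e : Fin n → Strand C}

/-- The band matrix is affine in the vertex matrix, so the determinant is polynomial in s; it will
be used with s = T^(tn) and one `g` for all t. -/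
theorem exists_bandDet_add_smul_eq {R : Type*} [CommRing R] (D : LongDiagram C) (T : Rˣ)
    (he : Function.Injective e) (P K : Matrix (Fin n) (Fin n) R) :
    ∃ g : Polynomial R, ∀ s : R, D.bandDet T e (P + s • K) = D.bandDet T e P + s * g.eval s := by
  obtain ⟨g, hg⟩ := exists_det_add_smul_eq (1 - D.transition T * bandMatrix e P)
    (-(D.transition T * (bandInclusion e R * K * (bandInclusion e R).transpose)))
  refine ⟨g, fun s => ?_⟩
  rw [bandDet, bandDet, ← hg]
  congr 1
  rw [bandMatrix_eq he, bandMatrix_eq he, add_sub_right_comm]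
  simp only [mul_add, mul_one, Matrix.mul_add, Matrix.add_mul, Matrix.mul_smul, Matrix.smul_mul,
    smul_neg]
  abel

theorem det_one_sub_transition_twist {R : Type*} [CommRing R] (D : LongDiagram C) (T : Rˣ)
    (he : Function.Injective e) (hn : 2 ≤ n) (t : ℕ) :
    (1 - (D.twist e t).transition T).det = D.bandDet T e (rowMatrix (T : R) ^ (t * n)) :=
  D.det_one_sub_transition_insertRows T he hn (t * n)

theorem firstOrder_det_twist {D : LongDiagram C} (hD : D.IsLongKnot) (he : Function.Injective e)
    (hn : 2 ≤ n) (t : ℕ) :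
    firstOrder (1 - (D.twist e t).transition unitT).det
      = 1 + (D.underFirst + (t : ℤ) * (n * (n - 1) / 2 : ℕ) : ℤ) *
        (DualNumber.eps : DualNumber ℤ) := by
  have hT : firstOrder (unitT : ℤ[T;T⁻¹]) = 1 + DualNumber.eps := by
    have := firstOrder_T 1
    rwa [Int.cast_one, one_mul] at this
  have hu : Units.map (firstOrder : ℤ[T;T⁻¹] →* DualNumber ℤ) unitT
      = epsUnit DualNumber.eps DualNumber.eps_mul_eps := Units.ext hT
  rw [det_one_sub_transition_twist D _ he hn, map_bandDet _ _ _ he, hu, ← bandDet_epsUnit hD he _ DualNumber.eps_mul_eps]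
  congr 1
  rw [← RingHom.mapMatrix_apply, map_pow, RingHom.mapMatrix_apply, rowMatrix_map, hT]

/-- The symmetrizing exponent is -`underFirst` - t n(n-1)/2, and the prefactor of p_t cancels its
second part, so t remains only in the power of the Burau matrix. -/
theorem alexanderPolynomial_twist {D : LongDiagram C} (hD : D.IsLongKnot)
    (he : Function.Injective e) (hn : 2 ≤ n) {t : ℕ} {f : ℤ[T;T⁻¹]}
    (hf : (D.twist e t).IsAlexanderPolynomial f) :
    LaurentPolynomial.T ((t * n * (n - 1) / 2 : ℕ) : ℤ) * f
      = LaurentPolynomial.T (-D.underFirst) *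
        D.bandDet unitT e (rowMatrix (LaurentPolynomial.T 1) ^ (t * n)) := by
  have h := hf.eq_T_mul_det (firstOrder_det_twist hD he hn t)
  have hdet := det_one_sub_transition_twist D unitT he hn t
  rw [h, hdet, ← mul_assoc, ← LaurentPolynomial.T_add, mul_assoc t,
    Nat.mul_div_assoc t (Nat.even_mul_pred_self n).two_dvd, Nat.cast_mul, neg_add_rev,
    add_neg_cancel_left]
  rfl

end LongDiagram

theorem geom_sum_ratFunc_ne_zero {n : ℕ} (hn : 0 < n) :
    ∑ i ∈ Finset.range n, (RatFunc.X : RatFunc ℚ) ^ i ≠ 0 := by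
  obtain ⟨w, hw, hw'⟩ := RegularAtOne.exists_geom_inverse hn
  intro h
  rw [h, inv_zero] at hw'
  have h1 := (RegularAtOne.denom_and_eval w).2
  rw [hw', RatFunc.eval_zero, hw] at h1
  have hn0 : (n : ℚ) ≠ 0 := by exact_mod_cast hn.ne'
  exact inv_ne_zero hn0 h1.symm

namespace LongDiagram

variable {C : Type*} [Fintype C] [DecidableEq C] {n : ℕ} {e : Fin n → Strand C}

/-- The limit of the Alexander polynomials of the twisted knots. -/
noncomputable def twistLimit (D : LongDiagram C) (e : Fin n → Strand C) : RatFunc ℚ :=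
  RatFunc.X ^ (-D.underFirst) * (1 - D.infiniteTwistMatrix e).det

/-- The only denominator in the chain is 1 + ⋯ + T^(n-1), with value n at 1. The determinant
therefore lives over the functions regular at 1, where it maps both to the field and to its value.
-/
theorem exists_toField_eq_twistLimit {D : LongDiagram C} (hD : D.IsLongKnot) (hn : 0 < n)
    (he : Function.Injective e) : ∃ d : RegularAtOne,
      RegularAtOne.toField d = D.twistLimit e ∧ RegularAtOne.value d = 1 / n := by
  obtain ⟨w, hw, hw'⟩ := RegularAtOne.exists_geom_inverse hn
  have hmap : ∀ {R : Type} [CommRing R] (φ : RegularAtOne →+* R),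
      (w • geomMatrix (RegularAtOne.unitX : RegularAtOne) :
        Matrix (Fin n) (Fin n) RegularAtOne).map φ
        = φ w • geomMatrix ((Units.map (φ : RegularAtOne →* R) RegularAtOne.unitX : Rˣ) : R) := by
    intro R _ φ
    rw [Units.coe_map, MonoidHom.coe_coe, ← geomMatrix_map φ]
    ext p q
    simp
  refine ⟨((RegularAtOne.unitX ^ (-D.underFirst) : RegularAtOneˣ) : RegularAtOne) *
    D.bandDet RegularAtOne.unitX e (w • geomMatrix (RegularAtOne.unitX : RegularAtOne)), ?_, ?_⟩
  · have hX : RegularAtOne.toField ((RegularAtOne.unitX ^ (-D.underFirst) : RegularAtOneˣ) :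
        RegularAtOne) = RatFunc.X ^ (-D.underFirst) := by
      change ((Units.map (RegularAtOne.toField : RegularAtOne →* RatFunc ℚ)
        (RegularAtOne.unitX ^ (-D.underFirst)) : (RatFunc ℚ)ˣ) : RatFunc ℚ) = _
      rw [map_zpow, RegularAtOne.map_toField_unitX, Units.val_zpow_eq_zpow_val]
      rfl
    rw [map_mul, hX, map_bandDet _ _ _ he, hmap, RegularAtOne.map_toField_unitX, hw', twistLimit,
      det_one_sub_infiniteTwistMatrix D he]
    rfl
  · have hX : RegularAtOne.value ((RegularAtOne.unitX ^ (-D.underFirst) : RegularAtOneˣ) :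
        RegularAtOne) = 1 := by
      change ((Units.map (RegularAtOne.value : RegularAtOne →* ℚ)
        (RegularAtOne.unitX ^ (-D.underFirst)) : ℚˣ) : ℚ) = _
      rw [map_zpow, RegularAtOne.map_value_unitX, one_zpow, Units.val_one]
    rw [map_mul, hX, map_bandDet _ _ _ he, hmap, RegularAtOne.map_value_unitX, hw, Units.val_one,
      bandDet_one_geomMatrix hD hn he, one_mul]

/-- As a rational function, p_t differs from the limit by X^(tn) times a fixed polynomial evaluated
at X^(tn), and this error leaves every bounded range of degrees. -/
theorem hasStableLimit_twistLimit {D : LongDiagram C} (hD : D.IsLongKnot) (hn : 2 ≤ n)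
    (he : Function.Injective e) {Δ : ℕ → ℤ[T;T⁻¹]}
    (hΔ : ∀ t, (D.twist e t).IsAlexanderPolynomial (Δ t)) :
    HasStableLimit (fun t => LaurentPolynomial.T ((t * n * (n - 1) / 2 : ℕ) : ℤ) * Δ t)
      (D.twistLimit e : LaurentSeries ℚ) := by
  set w : RatFunc ℚ := (∑ i ∈ Finset.range n, (RatFunc.X : RatFunc ℚ) ^ i)⁻¹ with hw
  have hw1 : w * ∑ i ∈ Finset.range n, (RatFunc.X : RatFunc ℚ) ^ i = 1 :=
    inv_mul_cancel₀ (geom_sum_ratFunc_ne_zero (by omega))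
  obtain ⟨g, hg⟩ := D.exists_bandDet_add_smul_eq unitX he (w • geomMatrix RatFunc.X)
    (1 - w • geomMatrix RatFunc.X)
  have hlim : D.twistLimit e = RatFunc.X ^ (-D.underFirst) *
      D.bandDet unitX e (w • geomMatrix RatFunc.X) := by
    rw [twistLimit, det_one_sub_infiniteTwistMatrix D he]
  have hT : toRatFunc (unitT : ℤ[T;T⁻¹]) = (RatFunc.X : RatFunc ℚ) :=
    (toRatFunc_T 1).trans (zpow_one _)
  have hu : Units.map ((toRatFunc : ℤ[T;T⁻¹] →+* RatFunc ℚ) : ℤ[T;T⁻¹] →* RatFunc ℚ) unitT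
      = unitX := Units.ext hT
  have key : ∀ t, toRatFunc (LaurentPolynomial.T ((t * n * (n - 1) / 2 : ℕ) : ℤ) * Δ t)
      = D.twistLimit e + RatFunc.X ^ (t * n) *
        (Polynomial.C (RatFunc.X ^ (-D.underFirst)) * g).eval (RatFunc.X ^ (t * n)) := by
    intro t
    have hrow : ((rowMatrix (LaurentPolynomial.T 1 : ℤ[T;T⁻¹]) : Matrix (Fin n) (Fin n) _) ^
        (t * n)).map (toRatFunc : ℤ[T;T⁻¹] →+* RatFunc ℚ) = w • geomMatrix RatFunc.X +
          (RatFunc.X ^ (t * n) : RatFunc ℚ) • (1 - w • geomMatrix RatFunc.X) := by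
      rw [← rowMatrix_pow_eq_add_smul _ _ hw1, ← RingHom.mapMatrix_apply, map_pow,
        RingHom.mapMatrix_apply, rowMatrix_map]
      exact congrArg (fun x => rowMatrix x ^ (t * n)) hT
    rw [alexanderPolynomial_twist hD he hn (hΔ t), map_mul, toRatFunc_T, map_bandDet _ _ _ he,
      hrow, hu, hg, hlim, Polynomial.eval_mul, Polynomial.eval_C]
    ring
  intro r₀
  obtain ⟨t₀, ht₀⟩ := exists_coeff_expansion_eq_zero (K := ℚ) (show 0 < n by omega)
    (Polynomial.C (RatFunc.X ^ (-D.underFirst)) * g) r₀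
  refine ⟨t₀, fun t ht r hr => ?_⟩
  have h1 := coeff_expansion_toRatFunc (K := ℚ)
    (LaurentPolynomial.T ((t * n * (n - 1) / 2 : ℕ) : ℤ) * Δ t) r
  rw [← h1, key t, map_add, HahnSeries.coeff_add]
  refine (congrArg (_ + ·) (ht₀ t ht r hr)).trans ?_
  rw [add_zero]
  rfl

end LongDiagram

/-- A rational function with integral coefficients whose value at `1` is not an integer is not a
Laurent polynomial. -/
theorem X_pow_mul_ne_algebraMap {d : RegularAtOne} {F : RatFunc ℚ}
    (hF : RegularAtOne.toField d = F) (hd : ∀ z : ℤ, RegularAtOne.value d ≠ z)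
    (hint : ∀ r : ℤ, ∃ z : ℤ, (F : LaurentSeries ℚ).coeff r = z) (j : ℕ) (q : Polynomial ℚ) :
    RatFunc.X ^ j * F ≠ algebraMap (Polynomial ℚ) (RatFunc ℚ) q := by
  intro h
  have hcoeff : ∀ i, ∃ z : ℤ, q.coeff i = z := by
    intro i
    obtain ⟨z, hz⟩ := hint (i - j)
    refine ⟨z, ?_⟩
    have h1 := coeff_expansion_algebraMap q i
    have h2 : expansion (RatFunc.X ^ j * F) = HahnSeries.single (j : ℤ) 1 * expansion F := by
      rw [map_mul, ← zpow_natCast]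
      exact congrArg (· * _) (expansion_X_zpow (K := ℚ) j)
    rw [← h1, ← hz]
    refine (congrArg (fun x => (expansion x).coeff (i : ℤ)) h.symm).trans ?_
    refine (congrArg (fun x => HahnSeries.coeff x (i : ℤ)) h2).trans ?_
    rw [HahnSeries.coeff_single_mul, one_mul]
    rfl
  -- The factor X^j has value 1 at 1.
  have hval : RegularAtOne.value d = q.eval 1 := by
    have h1 : RegularAtOne.toField (algebraMap _ _ (Polynomial.X ^ j : Polynomial ℚ) * d)
        = algebraMap _ _ q := by
      rw [map_mul, RegularAtOne.toField_algebraMap, hF, ← h, map_pow, RatFunc.algebraMap_X]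
    have h2 := (RegularAtOne.denom_and_eval
      (algebraMap _ _ (Polynomial.X ^ j : Polynomial ℚ) * d)).2
    rw [h1, RatFunc.eval_algebraMap, map_mul, RegularAtOne.value_algebraMap] at h2
    simpa [Polynomial.eval₂_id] using h2.symm
  choose z hz using hcoeff
  refine hd (∑ i ∈ Finset.range (q.natDegree + 1), z i) ?_
  rw [hval, Polynomial.eval_eq_sum_range]
  simp [hz]

end TwistedKnots

open TwistedKnots in
theorem theorem1p4 {C : Type*} [Fintype C] [DecidableEq C]
    -- a planar diagram of the knot `K₀`
    (D : LongDiagram C) (hD : D.IsLongKnot) (hplanar : D.IsPlanar)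
    -- `n ≥ 2` coherently oriented parallel strands
    (n : ℕ) (hn : 2 ≤ n) (e : Fin n → Strand C) (he : D.IsCoherentBand e)
    -- the symmetrized Alexander polynomials of the twisted knots `K_t`
    (Δ : ℕ → LaurentPolynomial ℤ) (hΔ : ∀ t, (D.twist e t).IsAlexanderPolynomial (Δ t)) :
    StabilizesPositively
        (fun t => LaurentPolynomial.T ((t * n * (n - 1) / 2 : ℕ) : ℤ) * Δ t) ∧
      ∃ F : RatFunc ℚ,
        -- the limit is the expansion of the rational function `F`
        HasStableLimit (fun t => LaurentPolynomial.T ((t * n * (n - 1) / 2 : ℕ) : ℤ) * Δ t)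
          (F : LaurentSeries ℚ) ∧
        -- explicit formula
        (∃ k : ℤ, 2 * k = -D.turningNumber - D.writhe ∧
          F = RatFunc.X ^ k * (1 - D.infiniteTwistMatrix e).det) ∧
        -- `F` is not a polynomial, not even a Laurent polynomial
        (∀ (j : ℕ) (q : Polynomial ℚ), RatFunc.X ^ j * F ≠ algebraMap (Polynomial ℚ) (RatFunc ℚ) q) ∧
        -- `F` is regular at `1`, with value `± 1 / n`
        F.denom.eval 1 ≠ 0 ∧
        (F.eval (RingHom.id ℚ) 1 = 1 / (n : ℚ) ∨ F.eval (RingHom.id ℚ) 1 = -(1 / (n : ℚ))) := by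
  have hlim := LongDiagram.hasStableLimit_twistLimit hD hn he.1 hΔ
  obtain ⟨d, hdF, hd⟩ := LongDiagram.exists_toField_eq_twistLimit hD (by omega : 0 < n) he.1
  have hreg := RegularAtOne.denom_and_eval d
  rw [hdF, hd] at hreg
  refine ⟨hlim.stabilizesPositively, D.twistLimit e, hlim, ⟨-D.underFirst, ?_, rfl⟩, ?_,
    hreg.1, Or.inl hreg.2⟩
  · linear_combination D.turningNumber_add_writhe
  · refine X_pow_mul_ne_algebraMap hdF (fun z hz => ?_) fun r => ?_
    -- If 1/n were an integer, n ≥ 2 would divide 1.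
    · have hn0 : (n : ℚ) ≠ 0 := by exact_mod_cast (by omega : n ≠ 0)
      rw [hd, div_eq_iff hn0] at hz
      have h1 : z * (n : ℤ) = 1 := by exact_mod_cast hz.symm
      have h2 := Int.eq_one_or_neg_one_of_mul_eq_one' h1
      omega
    -- Each coefficient of the limit is already a coefficient of some p_t, hence an integer.
    · obtain ⟨t₀, ht₀⟩ := hlim r
      exact ⟨_, (ht₀ t₀ le_rfl r le_rfl).symm⟩
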